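/- Let $A=\{a_1,\dots,a_n\}$ be a finite alphabet, let $A^{\pm}=A\sqcup A^{-1}$, and let $\mathbb{F}_n$ be the free group with basis $A$, whose elements are represented by the reduced words in $(A^{\pm})^*$; let $R_A$ be the set of all reduced words. For a subgroup $H\leq\mathbb{F}_n$, a $\vee$-cocycle of $H$ is an element $u\in\mathbb{F}_n$ with $\langle H,u\rangle=\mathbb{F}_n$; write $\mathrm{Coc}_\vee(H)$ for the set of these. A language is rational if it is obtained from the letters by finitely many unions, products and stars, and a subset of $\mathbb{F}_n$ is rational if it is the set of elements represented by the words of a rational language over $A^{\pm}$. Let $\Gamma=\mathrm{St}(H)$ be the Stallings automaton of $H$: the core of the right Schreier automaton of $H$ (its vertices are the right cosets $Hg$, with arcs $Hg\xrightarrow{x}Hgx$ for $x\in A^{\pm}$ and basepoint $\mathrm{bp}=H$), that is, its full subautomaton on the vertices lying on closed walks at $\mathrm{bp}$ with reduced label. For vertices $p,q$ of $\Gamma$, let $L_{p,q}$ be the set of labels of all walks from $p$ to $q$. Let $\Gamma/_{p=q}$ be the automaton obtained from $\Gamma$ by identifying $p$ and $q$, and $\overline{\Gamma/_{p=q}}$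 its Stallings reduction, that is, the Stallings automaton of the subgroup of $\mathbb{F}_n$ that it recognizes (the result of folding). For $B\subseteq A$, the bouquet on $B$ is the automaton with one vertex and one positive loop for each letter of $B$ (together with the inverse loops). Then, for every $n\geq 0$ and every finitely generated $H\leq\mathbb{F}_n$: 1. $\mathrm{Coc}_\vee(H)$ is a rational subset of $\mathbb{F}_n$, and the set of reduced words representing its elements is a rational language over $A^{\pm}$. 2. If $\Gamma$ has at least two vertices, then, as a set of reduced words, $$\mathrm{Coc}_\vee(H)=\Big(\bigcup_{(p,q)} L_{\mathrm{bp},p}\,L_{q,\mathrm{bp}}\Big)\cap R_A ,$$ where $(p,q)$ runs over all pairs of vertices of $\Gamma$ such that $\overline{\Gamma/_{p=q}}$ is the bouquet on $A$. 3. If $\Gamma$ has a single vertex, then $\Gamma$ is the bouquet on some $B\subseteq A$. If $B=A$, then $\mathrm{Coc}_\vee(H)=\mathbb{F}_n$. If $B=A\setminus\{a\}$ with $a\in A$, then $\mathrm{Coc}_\vee(H)=\mathbb{F}_B\,\{a,a^{-1}\}\,\mathbb{F}_B$, where $\mathbb{F}_B=\langle B\rangle$. If $|B|<|A|-1$, then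 $\mathrm{Coc}_\vee(H)=\varnothing$. Moreover, there is an algorithm that, given $n$ and a finite list of words in $(A^{\pm})^*$ whose values generate $H$, outputs a finite automaton whose language is exactly the set of reduced words representing the elements of $\mathrm{Coc}_\vee(H)$. -/

import Mathlib

universe u

namespace JoinCocycle

/-! ### Languages over the involutive alphabet

A letter of `A^±` is a pair `(a, b) : α × Bool`, standing for `a` if `b = true` and for the formal
inverse of `a` if `b = false`, as in Mathlib's `FreeGroup`. -/

/-- The formal inverse of a letter. -/
def letterInv {α : Type u} (x : α × Bool) : α × Bool := (x.1, !x.2)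

/-- A language is rational if it is obtained from the letters by finitely many unions, products
and stars, that is, if it is denoted by a regular expression. -/
def IsRationalLanguage {α : Type u} (L : Language α) : Prop :=
  ∃ R : RegularExpression α, R.matches' = L

/-- A subset of a free group is rational if it is the image of a rational language
over the involutive alphabet. -/
def IsRationalSubset {α : Type u} (S : Set (FreeGroup α)) : Prop :=
  ∃ L : Language (α × Bool), IsRationalLanguage L ∧ S = {g | ∃ w ∈ L, FreeGroup.mk w = g}

/-- The language `R_A` of all (freely) reduced words. -/
def reducedWords (α : Type u) : Language (α × Bool) := {w | FreeGroup.IsReduced w}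

/-- The language of the reduced words that represent the elements of `S`. -/
def reducedForms {α : Type u} (S : Set (FreeGroup α)) : Language (α × Bool) :=
  {w | FreeGroup.IsReduced w ∧ FreeGroup.mk w ∈ S}

/-! ### Involutive automata -/

/-- A pointed involutive automaton over `α`: a pointed directed multigraph (in the sense of Serre)
with arcs labelled by `α × Bool` and an inversion of arcs compatible with labels. (No arc is
its own inverse, since no letter is its own formal inverse.) -/
structure InvolutiveAutomaton (α : Type u) where
  /-- the vertices -/
  V : Type u
  /-- the arcs -/
  E : Type u
  /-- the origin of an arc -/
  init : E → V
  /-- the end of an arc -/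
  term : E → V
  /-- the label of an arc -/
  lab : E → α × Bool
  /-- the inversion of arcs -/
  inv : E → E
  /-- the basepoint -/
  base : V
  inv_inv : ∀ e, inv (inv e) = e
  init_inv : ∀ e, init (inv e) = term e
  lab_inv : ∀ e, lab (inv e) = letterInv (lab e)

namespace InvolutiveAutomaton

variable {α : Type u} (Γ : InvolutiveAutomaton α)

/-- `Γ.Reads p w q`: some walk of `Γ` from `p` to `q` has label `w`. -/
def Reads : Γ.V → List (α × Bool) → Γ.V → Prop
  | p, [], q => p = q
  | p, x :: w, q => ∃ e : Γ.E, Γ.init e = p ∧ Γ.lab e = x ∧ Reads (Γ.term e) w q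

/-- The language `L_{p,q}` of the labels of all walks from `p` to `q`. -/
def lang (p q : Γ.V) : Language (α × Bool) := {w | Γ.Reads p w q}

theorem term_inv (e : Γ.E) : Γ.term (Γ.inv e) = Γ.init e := by
  rw [← Γ.init_inv, Γ.inv_inv]

theorem reads_append {p q r : Γ.V} {v w : List (α × Bool)}
    (hv : Γ.Reads p v q) (hw : Γ.Reads q w r) : Γ.Reads p (v ++ w) r := by
  induction v generalizing p with
  | nil => cases hv; exact hw
  | cons x v ih =>
    obtain ⟨e, h1, h2, h3⟩ := hv
    exact ⟨e, h1, h2, ih h3⟩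

theorem reads_invRev {p q : Γ.V} {w : List (α × Bool)} (hw : Γ.Reads p w q) :
    Γ.Reads q (FreeGroup.invRev w) p := by
  induction w generalizing p with
  | nil => exact Eq.symm hw
  | cons x w ih =>
    obtain ⟨e, h1, h2, h3⟩ := hw
    have h : Γ.Reads (Γ.term e) [letterInv x] p :=
      ⟨Γ.inv e, Γ.init_inv e, by rw [Γ.lab_inv, h2], by rw [Γ.term_inv]; exact h1⟩
    simpa [FreeGroup.invRev, letterInv] using Γ.reads_append (ih h3) h

/-- The subgroup `⟨Γ⟩` recognized by `Γ`: the elements represented by labels of closed walks at the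
basepoint. -/
def subgroup : Subgroup (FreeGroup α) where
  carrier := {g | ∃ w ∈ Γ.lang Γ.base Γ.base, FreeGroup.mk w = g}
  one_mem' := ⟨[], rfl, rfl⟩
  mul_mem' := by
    rintro _ _ ⟨v, hv, rfl⟩ ⟨w, hw, rfl⟩
    exact ⟨v ++ w, Γ.reads_append hv hw, rfl⟩
  inv_mem' := by
    rintro _ ⟨v, hv, rfl⟩
    exact ⟨FreeGroup.invRev v, Γ.reads_invRev hv, rfl⟩

/-- `v` lies on some closed walk at the basepoint with reduced label. -/
def IsCoreVertex (v : Γ.V) : Prop :=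
  ∃ u w : List (α × Bool), Γ.Reads Γ.base u v ∧ Γ.Reads v w Γ.base ∧ FreeGroup.IsReduced (u ++ w)

/-- The core of a (deterministic) automaton: the full subautomaton on the vertices lying on closed
walks at the basepoint with reduced label. -/
def core : InvolutiveAutomaton α where
  V := {v : Γ.V // Γ.IsCoreVertex v}
  E := {e : Γ.E // Γ.IsCoreVertex (Γ.init e) ∧ Γ.IsCoreVertex (Γ.term e)}
  init e := ⟨Γ.init e.1, e.2.1⟩
  term e := ⟨Γ.term e.1, e.2.2⟩
  lab e := Γ.lab e.1
  inv e := ⟨Γ.inv e.1, by rw [Γ.init_inv]; exact e.2.2, by rw [Γ.term_inv]; exact e.2.1⟩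
  base := ⟨Γ.base, [], [], rfl, rfl, by simp [FreeGroup.IsReduced]⟩
  inv_inv e := Subtype.ext (Γ.inv_inv e.1)
  init_inv e := Subtype.ext (Γ.init_inv e.1)
  lab_inv e := Γ.lab_inv e.1

/-- The quotient of `Γ` obtained by identifying the vertices `p` and `q` (without folding). -/
def identify (p q : Γ.V) : InvolutiveAutomaton α where
  V := Quot (fun x y : Γ.V => x = p ∧ y = q)
  E := Γ.E
  init e := Quot.mk _ (Γ.init e)
  term e := Quot.mk _ (Γ.term e)
  lab := Γ.lab
  inv := Γ.inv
  base := Quot.mk _ Γ.base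
  inv_inv := Γ.inv_inv
  init_inv e := congrArg _ (Γ.init_inv e)
  lab_inv := Γ.lab_inv

/-- `Γ` is the bouquet on `B ⊆ A`: it has a single vertex and exactly one positive loop for each
letter in `B` (together with the inverse loops). -/
def IsBouquet (B : Set α) : Prop :=
  Subsingleton Γ.V ∧ Function.Injective Γ.lab ∧ Set.range Γ.lab = {x | x.1 ∈ B}

end InvolutiveAutomaton

/-! ### Schreier and Stallings automata -/

/-- Right multiplication by `x` on right cosets: `Hg ↦ Hgx`. -/
def cosetMul {G : Type u} [Group G] (H : Subgroup G) (x : G) :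
    Quotient (QuotientGroup.rightRel H) → Quotient (QuotientGroup.rightRel H) :=
  Quotient.map' (fun g => g * x) (fun a b h => by
    rw [QuotientGroup.rightRel_apply] at h ⊢
    simpa [mul_assoc] using h)

theorem cosetMul_inv {G : Type u} [Group G] (H : Subgroup G) (x : G)
    (v : Quotient (QuotientGroup.rightRel H)) : cosetMul H x⁻¹ (cosetMul H x v) = v := by
  induction v using Quotient.inductionOn' with
  | h g => simp [cosetMul, Quotient.map'_mk'']

theorem mk_letterInv {α : Type u} (x : α × Bool) :
    (FreeGroup.mk [letterInv x] : FreeGroup α) = (FreeGroup.mk [x])⁻¹ := by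
  simp [letterInv, FreeGroup.inv_mk, FreeGroup.invRev]

/-- The right Schreier automaton of `H`: vertices are the right cosets `Hg`, and for every letter
`x` of the involutive alphabet there is an arc from `Hg` to `Hgx` labelled `x`. -/
def schreier {α : Type u} (H : Subgroup (FreeGroup α)) : InvolutiveAutomaton α where
  V := Quotient (QuotientGroup.rightRel H)
  E := Quotient (QuotientGroup.rightRel H) × (α × Bool)
  init e := e.1
  term e := cosetMul H (FreeGroup.mk [e.2]) e.1
  lab e := e.2
  inv e := (cosetMul H (FreeGroup.mk [e.2]) e.1, letterInv e.2)
  base := Quotient.mk _ 1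
  inv_inv e := by
    apply Prod.ext
    · simp only [mk_letterInv, cosetMul_inv]
    · simp [letterInv]
  init_inv _ := rfl
  lab_inv _ := rfl

/-- The Stallings automaton of `H`: the core of its Schreier automaton. -/
def stallings {α : Type u} (H : Subgroup (FreeGroup α)) : InvolutiveAutomaton α :=
  (schreier H).core

/-- The Stallings reduction of an automaton: the deterministic core automaton that recognizes
the same subgroup (the result of folding). -/
def InvolutiveAutomaton.reduction {α : Type u} (Γ : InvolutiveAutomaton α) :
    InvolutiveAutomaton α :=
  stallings Γ.subgroup

/-- The set of (generators of) cyclic join-complements of `H`. -/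
def joinCocycles {α : Type u} (H : Subgroup (FreeGroup α)) : Set (FreeGroup α) :=
  {g | H ⊔ Subgroup.zpowers g = ⊤}

/-! ### Finite automata as data -/

/-- The description of a finite nondeterministic automaton over the letters `ℕ × Bool`: the number
`k` of states (the states are `0, …, k - 1`), the list of initial states, the list of transitions
`(source, letter, target)`, and the list of final states. -/
abbrev AutomatonCode : Type := ℕ × List ℕ × List (ℕ × (ℕ × Bool) × ℕ) × List ℕ

/-- The finite automaton given by its description. -/
def AutomatonCode.toNFA (c : AutomatonCode) : NFA (ℕ × Bool) (Fin c.1) where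
  start := {s | (s : ℕ) ∈ c.2.1}
  step s x := {t | ((s : ℕ), x, (t : ℕ)) ∈ c.2.2.1}
  accept := {s | (s : ℕ) ∈ c.2.2.2}

/-- A word over the involutive closure of `n` letters, written with the letters `0, …, n - 1`
(the form in which algorithms receive words). -/
def encodeWord {n : ℕ} (w : List (Fin n × Bool)) : List (ℕ × Bool) :=
  w.map fun x => ((x.1 : ℕ), x.2)

end JoinCocycle

/-! Everything rests on one fact about inverse automata, that is, deterministic involutive ones. Let
`T` be one that recognizes at least `H` at the vertex `b`, and let `u` be reduced. Read `u` forwards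
from `b` and backwards into `b`. If the two readings do not cover `u`, the unread middle can be
attached to `T` as a path without causing any folding (`IsInverse.exists_split_or_extension`). The
enlarged automaton recognizes both `H` and `u` and still contains `T` faithfully, so a letter `x`
that leads in `T` from `b` to another vertex cannot lie in `⟨H, u⟩`. Hence, if `⟨H, u⟩` contains
such an `x`, then `u = u₁ u₂` with `u₁` readable from `b` and `u₂` readable into `b`
(`IsInverse.exists_split`).

In a Stallings automaton with two vertices some letter leaves the basepoint, so every cocycle is
read with one jump from a vertex `p` to a vertex `q`. By `identify_subgroup`, `⟨H, u₁ u₂⟩` is the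
subgroup recognized after identifying `p` and `q`, so it depends only on the pair. If there is a
single vertex, `H` is generated by a set of letters. With one letter `a` missing, the same fact is
applied to the bouquet with a pendant arc `a`; with two missing, abelianization to `ℤ²` excludes a
cyclic complement.

The algorithm replaces the Stallings automaton by the part of the Schreier automaton on the cosets
named by short words. There a letter leaves the trivial coset whenever `H` is proper, so no case
distinction on the number of vertices is needed. Arcs, jumps and final states are decided by a
membership test that saturates a ball under division (`mem_of_mem_closure_of_locally_closed`).
Rationality follows by applying Kleene's construction to the resulting automaton. -/

namespace JoinCocycle

/-! ### Walks in labelled transition relations -/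

/-- `Walk T p w q`: the word `w` labels a walk from `p` to `q` in the transition relation `T`. -/
def Walk {V β : Type*} (T : V → β → V → Prop) : V → List β → V → Prop
  | p, [], q => p = q
  | p, x :: w, q => ∃ r, T p x r ∧ Walk T r w q

section Walk

variable {V W β : Type*} {T : V → β → V → Prop}

theorem Walk.single {p q : V} {x : β} (h : T p x q) : Walk T p [x] q := ⟨q, h, rfl⟩

theorem walk_append {p q : V} {v w : List β} :
    Walk T p (v ++ w) q ↔ ∃ r, Walk T p v r ∧ Walk T r w q := by
  induction v generalizing p with
  | nil => simp [Walk]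
  | cons x v ih =>
    simp only [List.cons_append, Walk, ih]
    constructor
    · rintro ⟨r, h, s, h1, h2⟩
      exact ⟨s, ⟨r, h, h1⟩, h2⟩
    · rintro ⟨s, ⟨r, h, h1⟩, h2⟩
      exact ⟨r, h, s, h1, h2⟩

theorem Walk.append {p q r : V} {v w : List β} (hv : Walk T p v q) (hw : Walk T q w r) :
    Walk T p (v ++ w) r := walk_append.2 ⟨q, hv, hw⟩

theorem Walk.map {T' : W → β → W → Prop} {f : V → W}
    (hf : ∀ a x b, T a x b → T' (f a) x (f b)) {p q : V} {w : List β} (h : Walk T p w q) :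
    Walk T' (f p) w (f q) := by
  induction w generalizing p with
  | nil => exact congrArg f h
  | cons x w ih =>
    obtain ⟨r, h1, h2⟩ := h
    exact ⟨f r, hf _ _ _ h1, ih h2⟩

end Walk

/-! ### Inverse automata: free reduction of labels and extension without folding -/

/-- A transition relation over the involutive alphabet is inverse if it is deterministic and
closed under inversion of arcs. -/
structure IsInverse {α V : Type*} (T : V → α × Bool → V → Prop) : Prop where
  symm : ∀ {p x q}, T p x q → T q (letterInv x) p
  det : ∀ {p x q r}, T p x q → T p x r → q = r

@[simp] theorem letterInv_letterInv {α : Type*} (x : α × Bool) :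
    letterInv (letterInv x) = x := by simp [letterInv]

theorem letterInv_ne {α : Type*} (x : α × Bool) : letterInv x ≠ x := by
  intro h
  have := congrArg Prod.snd h
  simp [letterInv] at this

theorem isReduced_cons_cons_iff {α : Type*} {x y : α × Bool} {w : List (α × Bool)} :
    FreeGroup.IsReduced (x :: y :: w) ↔ y ≠ letterInv x ∧ FreeGroup.IsReduced (y :: w) := by
  rw [FreeGroup.isReduced_cons_cons]
  refine and_congr_left fun _ => ?_
  obtain ⟨a, b⟩ := x
  obtain ⟨c, d⟩ := y
  simp only [letterInv, ne_eq, Prod.mk.injEq, not_and]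
  constructor
  · rintro h rfl; simp [h rfl]
  · rintro h rfl; have := h rfl; revert this; cases b <;> cases d <;> simp

theorem invRev_cons {α : Type*} (x : α × Bool) (w : List (α × Bool)) :
    FreeGroup.invRev (x :: w) = FreeGroup.invRev w ++ [letterInv x] := by
  simp [FreeGroup.invRev, letterInv]

namespace IsInverse

variable {α V : Type*} {T : V → α × Bool → V → Prop} (hT : IsInverse T)
include hT

theorem walk_det {p q r : V} {w : List (α × Bool)} (h : Walk T p w q) (h' : Walk T p w r) :
    q = r := by
  induction w generalizing p with
  | nil => exact Eq.trans (Eq.symm h) h'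
  | cons x w ih =>
    obtain ⟨s, h1, h2⟩ := h
    obtain ⟨s', h1', h2'⟩ := h'
    cases hT.det h1 h1'
    exact ih h2 h2'

theorem walk_invRev {p q : V} {w : List (α × Bool)} (h : Walk T p w q) :
    Walk T q (FreeGroup.invRev w) p := by
  induction w generalizing p with
  | nil => exact Eq.symm h
  | cons x w ih =>
    obtain ⟨s, h1, h2⟩ := h
    rw [invRev_cons]
    exact (ih h2).append (.single (hT.symm h1))

/-- A cancelling pair of letters leaves along an arc and, by determinism, returns along its inverse,
so it can be cut out of the walk. -/
theorem walk_of_red {p q : V} {w w' : List (α × Bool)} (hr : FreeGroup.Red w w')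
    (h : Walk T p w q) : Walk T p w' q := by
  induction hr with
  | refl => exact h
  | tail _ hs ih =>
    cases hs with
    | @not L₁ L₂ a b =>
      obtain ⟨r, h1, s, h2, t, h3, h4⟩ := walk_append.1 ih
      cases hT.det (hT.symm h2) h3
      exact h1.append h4

/-- The elements represented by the labels of closed walks at `b`. -/
def subgroup (b : V) : Subgroup (FreeGroup α) where
  carrier := {g | ∃ w, Walk T b w b ∧ FreeGroup.mk w = g}
  one_mem' := ⟨[], rfl, rfl⟩
  mul_mem' := by
    rintro _ _ ⟨v, hv, rfl⟩ ⟨w, hw, rfl⟩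
    exact ⟨v ++ w, hv.append hw, rfl⟩
  inv_mem' := by
    rintro _ ⟨v, hv, rfl⟩
    exact ⟨FreeGroup.invRev v, hT.walk_invRev hv, rfl⟩

theorem walk_of_mem_subgroup {b : V} {w : List (α × Bool)} (hw : FreeGroup.IsReduced w)
    (h : FreeGroup.mk w ∈ hT.subgroup b) : Walk T b w b := by
  classical
  obtain ⟨v, hv, hvw⟩ := h
  have := FreeGroup.reduce.sound hvw
  rw [hw.reduce_eq] at this
  exact hT.walk_of_red (this ▸ FreeGroup.reduce.red) hv

end IsInverse

/-- The transition relation obtained by adding an arc and its inverse. -/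
def addArc {α V : Type*} (T : V → α × Bool → V → Prop) (p : V) (x : α × Bool) (q : V) :
    V → α × Bool → V → Prop :=
  fun r y s => T r y s ∨ (r = p ∧ y = x ∧ s = q) ∨ (r = q ∧ y = letterInv x ∧ s = p)

/-- By `hp` and `hq` the new arc and its inverse compete with no old arc. They do not compete with
each other even if `p = q`, since a letter differs from its inverse. -/
theorem IsInverse.addArc {α V : Type*} {T : V → α × Bool → V → Prop} (hT : IsInverse T)
    {p q : V} {x : α × Bool} (hp : ∀ s, ¬ T p x s) (hq : ∀ s, ¬ T q (letterInv x) s) :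
    IsInverse (addArc T p x q) where
  symm := by
    rintro r y s (h | ⟨rfl, rfl, rfl⟩ | ⟨rfl, rfl, rfl⟩)
    · exact .inl (hT.symm h)
    · exact .inr (.inr ⟨rfl, rfl, rfl⟩)
    · exact .inr (.inl ⟨rfl, letterInv_letterInv _, rfl⟩)
  det := by
    rintro r y s t (h | ⟨rfl, rfl, rfl⟩ | ⟨rfl, rfl, rfl⟩) (h' | ⟨h1, h2, rfl⟩ | ⟨h1, h2, rfl⟩)
    · exact hT.det h h'
    · subst h1 h2; exact absurd h (hp _)
    · subst h1 h2; exact absurd h (hq _)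
    · exact absurd h' (hp _)
    · rfl
    · exact absurd h2.symm (letterInv_ne _)
    · exact absurd h' (hq _)
    · exact absurd h2 (letterInv_ne _)
    · rfl

/-- The transition relation obtained by adding an isolated vertex. -/
def addVertex {β V : Type*} (T : V → β → V → Prop) : Option V → β → Option V → Prop :=
  fun r y s => ∃ r' s', r = some r' ∧ s = some s' ∧ T r' y s'

theorem IsInverse.addVertex {α V : Type*} {T : V → α × Bool → V → Prop} (hT : IsInverse T) :
    IsInverse (addVertex T) where
  symm := by
    rintro _ y _ ⟨r, s, rfl, rfl, h⟩
    exact ⟨s, r, rfl, rfl, hT.symm h⟩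
  det := by
    rintro _ y _ _ ⟨r, s, rfl, rfl, h⟩ ⟨r', s', h1, rfl, h'⟩
    cases h1
    rw [hT.det h h']

/-- A reduced word either splits into a prefix readable from `p` and a suffix readable into `q`,
or it can be made the label of a walk from `p` to `q` in a larger inverse relation. -/
theorem IsInverse.exists_split_or_extension {α : Type*} {V : Type u}
    {T : V → α × Bool → V → Prop} (hT : IsInverse T) (p q : V) (u : List (α × Bool))
    (hu : FreeGroup.IsReduced u) :
    (∃ u₁ u₂ r s, u = u₁ ++ u₂ ∧ Walk T p u₁ r ∧ Walk T s u₂ q) ∨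
    ∃ (W : Type u) (T' : W → α × Bool → W → Prop) (ι : V → W), IsInverse T' ∧
      Function.Injective ι ∧ (∀ a x b, T a x b → T' (ι a) x (ι b)) ∧ Walk T' (ι p) u (ι q) := by
  induction hk : u.length generalizing V u with
  | zero =>
    obtain rfl := List.length_eq_zero_iff.1 hk
    exact .inl ⟨[], [], p, q, rfl, rfl, rfl⟩
  | succ k ih =>
    -- A letter readable at either end is absorbed: `p` advances along it, or `q` retreats along it,
    -- and the induction continues with the shorter word.
    by_cases hp : ∃ x w r, u = x :: w ∧ T p x r
    · obtain ⟨x, w, r, rfl, h⟩ := hp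
      rcases ih hT r q w (hu.infix (List.suffix_cons x w).isInfix) (by simpa using hk) with
        ⟨u₁, u₂, r', s, rfl, h1, h2⟩ | ⟨W, T', ι, hT', hι, hm, hw⟩
      · exact .inl ⟨x :: u₁, u₂, r', s, rfl, ⟨r, h, h1⟩, h2⟩
      · exact .inr ⟨W, T', ι, hT', hι, hm, _, hm _ _ _ h, hw⟩
    by_cases hq : ∃ y w r, u = w ++ [y] ∧ T r y q
    · obtain ⟨y, w, r, rfl, h⟩ := hq
      rcases ih hT p r w (hu.infix (List.prefix_append w [y]).isInfix) (by simpa using hk) with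
        ⟨u₁, u₂, r', s, rfl, h1, h2⟩ | ⟨W, T', ι, hT', hι, hm, hw⟩
      · exact .inl ⟨u₁, u₂ ++ [y], r', s, by simp, h1, h2.append (.single h)⟩
      · exact .inr ⟨W, T', ι, hT', hι, hm, hw.append (.single (hm _ _ _ h))⟩
    push Not at hp hq
    right
    obtain ⟨x, w, rfl⟩ := List.exists_cons_of_length_eq_add_one hk
    -- Now `u` is blocked at both ends. A single letter becomes an arc from `p` to `q`; otherwise
    -- the first letter leads to a fresh vertex `none`, from which the rest is to be read.
    have hpx : ∀ s, ¬ T p x s := fun s => hp x w s rfl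
    rcases w.eq_nil_or_concat' with rfl | ⟨v, y, rfl⟩
    · refine ⟨V, JoinCocycle.addArc T p x q, id, hT.addArc hpx fun s h => ?_, fun _ _ h => h,
        fun _ _ _ h => .inl h, .single (.inr (.inl ⟨rfl, rfl, rfl⟩))⟩
      exact hq x [] s rfl (by simpa using hT.symm h)
    · have hqy : ∀ s, ¬ T s y q := fun s => hq y (x :: v) s (by simp)
      let T₁ := JoinCocycle.addArc (JoinCocycle.addVertex T) (some p) x none
      have hT₁ : IsInverse T₁ := by
        refine hT.addVertex.addArc ?_ ?_
        · rintro s ⟨r', s', h1, -, h⟩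
          cases h1
          exact hpx _ h
        · rintro s ⟨r', s', h1, -, h⟩
          cases h1
      have hinto : ∀ s z, T₁ s z none → z = x := by
        rintro s z (⟨_, _, _, h, _⟩ | ⟨_, h, _⟩ | ⟨_, _, h⟩)
        · cases h
        · exact h
        · cases h
      have hout : ∀ s z, T₁ none z s → z = letterInv x := by
        intro s z h
        rw [← letterInv_letterInv z, hinto _ _ (hT₁.symm h)]
      have hlast : ∀ s, T₁ s y (some q) → s = none ∧ y = letterInv x := by
        rintro s (⟨r', s', -, h1, h⟩ | ⟨_, _, h⟩ | ⟨h1, h2, _⟩)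
        · cases h1
          exact absurd h (hqy _)
        · cases h
        · exact ⟨h1, h2⟩
      rcases ih hT₁ none (some q) (v ++ [y]) (hu.infix (List.suffix_cons x _).isInfix)
          (by simpa using hk) with
        ⟨u₁, u₂, r', s, he, h1, h2⟩ | ⟨W, T', ι, hT', hι, hm, hw⟩
      -- The rest cannot split. A nonempty prefix readable from `none` starts with `letterInv x`,
      -- right after `x`. If the prefix is empty, the last letter enters `some q`, which only the
      -- inverse of the new arc can do, so it is `letterInv x` and its predecessor in `u` is `x`.
      -- Both contradict reducedness.
      · exfalso
        cases u₁ with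
        | cons z u₁ =>
          obtain ⟨t, h, -⟩ := h1
          rw [he, List.cons_append, isReduced_cons_cons_iff] at hu
          exact hu.1 (hout _ _ h)
        | nil =>
          obtain rfl : v ++ [y] = u₂ := he
          obtain ⟨t, h3, t', h4, rfl⟩ := walk_append.1 h2
          obtain ⟨rfl, rfl⟩ := hlast _ h4
          rcases v.eq_nil_or_concat' with rfl | ⟨v, z, rfl⟩
          · exact (isReduced_cons_cons_iff.1 hu).1 rfl
          · obtain ⟨t, h5, t', h6, rfl⟩ := walk_append.1 h3
            obtain rfl := hinto _ _ h6
            have := hu.infix (L₁ := [z, letterInv z]) ⟨z :: v, [], by simp⟩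
            exact (isReduced_cons_cons_iff.1 this).1 rfl
      · exact ⟨W, T', ι ∘ some, hT', hι.comp (Option.some_injective V),
          fun a z b h => hm _ _ _ (.inl ⟨a, b, rfl, rfl, h⟩), _,
          hm _ _ _ (.inr (.inl ⟨rfl, rfl, rfl⟩)), hw⟩

/-- If a letter that labels an arc from `b` to another vertex lies in the join of `H` and the
reduced word `u`, then `u` is readable from `b` up to one jump. -/
theorem IsInverse.exists_split {α : Type*} {V : Type u} {T : V → α × Bool → V → Prop}
    (hT : IsInverse T) {b c : V} {x : α × Bool} (hbc : T b x c) (hne : c ≠ b)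
    {H : Subgroup (FreeGroup α)} (hH : H ≤ hT.subgroup b) {u : List (α × Bool)}
    (hu : FreeGroup.IsReduced u)
    (hx : FreeGroup.mk [x] ∈ H ⊔ Subgroup.zpowers (FreeGroup.mk u)) :
    ∃ u₁ u₂ r s, u = u₁ ++ u₂ ∧ Walk T b u₁ r ∧ Walk T s u₂ b := by
  rcases hT.exists_split_or_extension b b u hu with h | ⟨W, T', ι, hT', hι, hm, hw⟩
  · exact h
  · exfalso
    have hle : H ⊔ Subgroup.zpowers (FreeGroup.mk u) ≤ hT'.subgroup (ι b) := by
      refine sup_le (fun g hg => ?_) (by simpa using ⟨u, hw, rfl⟩)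
      obtain ⟨w, hw, rfl⟩ := hH hg
      exact ⟨w, hw.map hm, rfl⟩
    -- In the extension `x` labels a loop at `ι b`, yet the arc `hbc` still leads from there to `ι c
    -- ≠ ι b`.
    obtain ⟨r, h1, h2⟩ := hT'.walk_of_mem_subgroup .singleton (hle hx)
    exact hne (hι ((hT'.det (hm _ _ _ hbc) h1).trans h2))

/-! ### Right cosets -/

section Coset

variable {G : Type u} [Group G] (H : Subgroup G)

@[simp] theorem cosetMul_mk (x g : G) :
    cosetMul H x (Quotient.mk _ g) = Quotient.mk _ (g * x) := rfl

theorem cosetMul_one (v : Quotient (QuotientGroup.rightRel H)) : cosetMul H 1 v = v := by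
  induction v using Quotient.inductionOn with
  | h g => simp

theorem cosetMul_mul (x y : G) (v : Quotient (QuotientGroup.rightRel H)) :
    cosetMul H (x * y) v = cosetMul H y (cosetMul H x v) := by
  induction v using Quotient.inductionOn with
  | h g => simp [mul_assoc]

theorem coset_eq_iff {g h : G} :
    (Quotient.mk (QuotientGroup.rightRel H) g = Quotient.mk _ h) ↔ g * h⁻¹ ∈ H := by
  rw [Quotient.eq, QuotientGroup.rightRel_apply, ← H.inv_mem_iff]
  simp

/-- The map on right cosets induced by an inclusion of subgroups. -/
def cosetMap {H K : Subgroup G} (h : H ≤ K) :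
    Quotient (QuotientGroup.rightRel H) → Quotient (QuotientGroup.rightRel K) :=
  Quotient.map' id (fun a b hab => by
    rw [QuotientGroup.rightRel_apply] at hab ⊢
    exact h hab)

theorem cosetMap_cosetMul {H K : Subgroup G} (h : H ≤ K) (x : G)
    (v : Quotient (QuotientGroup.rightRel H)) :
    cosetMap h (cosetMul H x v) = cosetMul K x (cosetMap h v) := by
  induction v using Quotient.inductionOn with
  | h g => rfl

end Coset

theorem mk_cons {α : Type*} (x : α × Bool) (w : List (α × Bool)) :
    (FreeGroup.mk (x :: w) : FreeGroup α) = FreeGroup.mk [x] * FreeGroup.mk w := by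
  rw [FreeGroup.mul_mk]; rfl

theorem mk_nil {α : Type*} : (FreeGroup.mk [] : FreeGroup α) = 1 := rfl

/-! ### Walks in involutive automata -/

namespace InvolutiveAutomaton

variable {α : Type u} (Γ : InvolutiveAutomaton α)

/-- The transition relation of an involutive automaton. -/
def Step (p : Γ.V) (x : α × Bool) (q : Γ.V) : Prop :=
  ∃ e : Γ.E, Γ.init e = p ∧ Γ.lab e = x ∧ Γ.term e = q

theorem reads_iff_walk {p q : Γ.V} {w : List (α × Bool)} :
    Γ.Reads p w q ↔ Walk Γ.Step p w q := by
  induction w generalizing p with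
  | nil => rfl
  | cons x w ih =>
    simp only [Reads, Walk, ih]
    constructor
    · rintro ⟨e, h1, h2, h3⟩
      exact ⟨_, ⟨e, h1, h2, rfl⟩, h3⟩
    · rintro ⟨_, ⟨e, h1, h2, rfl⟩, h3⟩
      exact ⟨e, h1, h2, h3⟩

theorem mem_lang {p q : Γ.V} {w : List (α × Bool)} : w ∈ Γ.lang p q ↔ Walk Γ.Step p w q :=
  Γ.reads_iff_walk

theorem mem_subgroup {g : FreeGroup α} :
    g ∈ Γ.subgroup ↔ ∃ w, Walk Γ.Step Γ.base w Γ.base ∧ FreeGroup.mk w = g := by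
  simp only [← reads_iff_walk]; rfl

/-- Each vertex passed while reading `v` lies on the same reduced closed walk `u ++ v ++ w`, hence
in the core. -/
theorem walk_core {p q : Γ.V} {u v w : List (α × Bool)} (hu : Walk Γ.Step Γ.base u p)
    (hv : Walk Γ.Step p v q) (hw : Walk Γ.Step q w Γ.base) (hr : FreeGroup.IsReduced (u ++ v ++ w))
    (hp : Γ.IsCoreVertex p) :
    ∃ hq : Γ.IsCoreVertex q, Walk Γ.core.Step ⟨p, hp⟩ v ⟨q, hq⟩ := by
  induction v generalizing u p with
  | nil =>
    cases hv
    exact ⟨hp, rfl⟩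
  | cons x v ih =>
    obtain ⟨r, h1, h2⟩ := hv
    have hu' := hu.append (.single h1)
    have hr' : FreeGroup.IsReduced (u ++ [x] ++ v ++ w) := by simpa using hr
    have hrc : Γ.IsCoreVertex r :=
      ⟨u ++ [x], v ++ w, Γ.reads_iff_walk.2 hu', Γ.reads_iff_walk.2 (h2.append hw),
        by simpa using hr⟩
    obtain ⟨hq, h⟩ := ih hu' h2 hr' hrc
    refine ⟨hq, ⟨r, hrc⟩, ?_, h⟩
    obtain ⟨e, rfl, rfl, rfl⟩ := h1
    exact ⟨⟨e, hp, hrc⟩, rfl, rfl, rfl⟩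

theorem walk_core_base {p : Γ.V} {u w : List (α × Bool)} (hu : Walk Γ.Step Γ.base u p)
    (hw : Walk Γ.Step p w Γ.base) (hr : FreeGroup.IsReduced (u ++ w)) :
    ∃ hp : Γ.IsCoreVertex p, Walk Γ.core.Step Γ.core.base u ⟨p, hp⟩ :=
  Γ.walk_core (u := []) rfl hu hw hr _

theorem exists_walk_core (p : Γ.core.V) : ∃ u, Walk Γ.core.Step Γ.core.base u p := by
  obtain ⟨p, u, w, hu, hw, hr⟩ := p
  obtain ⟨_, h⟩ := Γ.walk_core_base (Γ.reads_iff_walk.1 hu) (Γ.reads_iff_walk.1 hw) hr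
  exact ⟨u, h⟩

end InvolutiveAutomaton

/-- Supplies the letter leaving the basepoint that `IsInverse.exists_split` requires. -/
theorem Walk.exists_exit {V β : Type*} {T : V → β → V → Prop} {b c : V} {w : List β}
    (h : Walk T b w c) (hne : c ≠ b) : ∃ x d, T b x d ∧ d ≠ b := by
  induction w with
  | nil => exact absurd (Eq.symm h) hne
  | cons x w ih =>
    obtain ⟨r, h1, h2⟩ := h
    by_cases hr : r = b
    · exact ih (hr ▸ h2)
    · exact ⟨x, r, h1, hr⟩

/-! ### Schreier and Stallings automata -/

section Stallings

variable {α : Type u} (H : Subgroup (FreeGroup α))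

theorem schreier_step {p q : (schreier H).V} {x : α × Bool} :
    (schreier H).Step p x q ↔ cosetMul H (FreeGroup.mk [x]) p = q := by
  constructor
  · rintro ⟨e, rfl, rfl, rfl⟩
    rfl
  · rintro rfl
    exact ⟨(p, x), rfl, rfl, rfl⟩

theorem schreier_walk {p q : (schreier H).V} {w : List (α × Bool)} :
    Walk (schreier H).Step p w q ↔ cosetMul H (FreeGroup.mk w) p = q := by
  induction w generalizing p with
  | nil => exact Eq.congr_left (cosetMul_one H p).symm
  | cons x w ih =>
    refine Iff.trans ?_ (Eq.congr_left (cosetMul_mul H (FreeGroup.mk [x]) (FreeGroup.mk w) p).symm)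
    simp only [Walk, schreier_step, ih]
    exact exists_eq_left'

theorem schreier_walk_base {w : List (α × Bool)} :
    Walk (schreier H).Step (schreier H).base w (schreier H).base ↔ FreeGroup.mk w ∈ H := by
  rw [schreier_walk]
  change (Quotient.mk (QuotientGroup.rightRel H) (1 * FreeGroup.mk w) = Quotient.mk _ 1) ↔ _
  rw [coset_eq_iff]
  simp

theorem stallings_step {p q : (stallings H).V} {x : α × Bool} :
    (stallings H).Step p x q ↔ cosetMul H (FreeGroup.mk [x]) p.1 = q.1 := by
  constructor
  · rintro ⟨e, rfl, rfl, rfl⟩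
    rfl
  · intro h
    exact ⟨⟨(p.1, x), p.2, (congrArg (schreier H).IsCoreVertex h).mpr q.2⟩, rfl, rfl, Subtype.ext h⟩

theorem stallings_walk {p q : (stallings H).V} {w : List (α × Bool)}
    (h : Walk (stallings H).Step p w q) : cosetMul H (FreeGroup.mk w) p.1 = q.1 := by
  rw [← schreier_walk]
  exact h.map (f := Subtype.val) fun _ _ _ h => (schreier_step H).2 ((stallings_step H).1 h)

theorem stallings_isInverse : IsInverse (stallings H).Step where
  symm h := by
    rw [stallings_step] at h ⊢
    rw [mk_letterInv, ← h]
    exact cosetMul_inv H _ _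
  det h h' := by
    rw [stallings_step] at h h'
    exact Subtype.ext (h.symm.trans h')

theorem stallings_walk_base {w : List (α × Bool)} (hw : FreeGroup.IsReduced w)
    (h : FreeGroup.mk w ∈ H) :
    Walk (stallings H).Step (stallings H).base w (stallings H).base :=
  ((schreier H).walk_core_base ((schreier_walk_base H).2 h) (w := []) rfl (by simpa using hw)).2

theorem exists_stallings_walk {g : FreeGroup α} (hg : g ∈ H) :
    ∃ w, Walk (stallings H).Step (stallings H).base w (stallings H).base ∧ FreeGroup.mk w = g := by
  classical
  exact ⟨g.toWord, stallings_walk_base H FreeGroup.isReduced_toWord (by rwa [FreeGroup.mk_toWord]),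
    FreeGroup.mk_toWord⟩

theorem stallings_lab_injective [Subsingleton (stallings H).V] :
    Function.Injective (stallings H).lab := by
  rintro ⟨⟨p, x⟩, hp⟩ ⟨⟨q, y⟩, hq⟩ (rfl : x = y)
  have := @Subsingleton.elim (stallings H).V _ ⟨p, hp.1⟩ ⟨q, hq.1⟩
  obtain rfl : p = q := congrArg Subtype.val this
  rfl

theorem stallings_mem_range_lab [Subsingleton (stallings H).V] {x : α × Bool} :
    x ∈ Set.range (stallings H).lab ↔ FreeGroup.mk [x] ∈ H := by
  constructor
  · rintro ⟨e, rfl⟩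
    rw [← schreier_walk_base, schreier_walk]
    have := stallings_walk H (.single ⟨e, rfl, rfl, rfl⟩)
    rwa [Subsingleton.elim ((stallings H).init e) (stallings H).base,
      Subsingleton.elim ((stallings H).term e) (stallings H).base] at this
  · intro h
    obtain ⟨_, ⟨e, -, h, -⟩, -⟩ := stallings_walk_base H .singleton h
    exact ⟨e, h⟩

theorem mk_single_mem_iff {a : α} {b : Bool} :
    FreeGroup.mk [(a, b)] ∈ H ↔ FreeGroup.of a ∈ H := by
  cases b
  · rw [show ((a, false) : α × Bool) = letterInv (a, true) from rfl, mk_letterInv, H.inv_mem_iff]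
    rfl
  · rfl

theorem eq_top_of_of_mem (h : ∀ a, FreeGroup.of a ∈ H) : H = ⊤ := by
  rw [← top_le_iff, ← FreeGroup.closure_range_of, Subgroup.closure_le]
  rintro _ ⟨a, rfl⟩
  exact h a

theorem stallings_isBouquet [Subsingleton (stallings H).V] :
    (stallings H).IsBouquet {a | FreeGroup.of a ∈ H} := by
  refine ⟨inferInstance, stallings_lab_injective H, Set.ext fun ⟨a, b⟩ => ?_⟩
  rw [stallings_mem_range_lab, mk_single_mem_iff]
  rfl

theorem stallings_isBouquet_univ : (stallings H).IsBouquet Set.univ ↔ H = ⊤ := by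
  constructor
  · rintro ⟨h1, -, h3⟩
    refine eq_top_of_of_mem H fun a => ?_
    have : (a, true) ∈ Set.range (stallings H).lab := by simp [h3]
    exact (stallings_mem_range_lab H).1 this
  · rintro rfl
    have : Subsingleton (stallings (⊤ : Subgroup (FreeGroup α))).V := by
      refine ⟨fun p q => Subtype.ext ?_⟩
      obtain ⟨p, -⟩ := p
      obtain ⟨q, -⟩ := q
      induction p using Quotient.inductionOn
      induction q using Quotient.inductionOn
      exact (coset_eq_iff _).2 trivial
    simpa using stallings_isBouquet (⊤ : Subgroup (FreeGroup α))

theorem identify_walk {Γ : InvolutiveAutomaton α} (p q : Γ.V) {r s : Γ.V} {w : List (α × Bool)}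
    (h : Walk Γ.Step r w s) :
    Walk (Γ.identify p q).Step (Quot.mk _ r) w (Quot.mk _ s) := by
  refine h.map (f := fun v => (Quot.mk _ v : (Γ.identify p q).V)) ?_
  rintro _ _ _ ⟨e, rfl, rfl, rfl⟩
  exact ⟨e, rfl, rfl, rfl⟩

/-- With `K` the join, `Hg ↦ Kg` sends `p` and `q` to the same coset because `uv ∈ K`. It therefore
factors through the identification as a map into the Schreier automaton of `K`, where closed walks
at the basepoint have labels in `K`. Conversely, gluing `p` to `q` closes the walk `uv`. -/
theorem identify_subgroup {p q : (stallings H).V} {u v : List (α × Bool)}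
    (hu : Walk (stallings H).Step (stallings H).base u p)
    (hv : Walk (stallings H).Step q v (stallings H).base) :
    ((stallings H).identify p q).subgroup = H ⊔ Subgroup.zpowers (FreeGroup.mk (u ++ v)) := by
  apply le_antisymm
  · intro g hg
    set K := H ⊔ Subgroup.zpowers (FreeGroup.mk (u ++ v)) with hK
    have hHK : H ≤ K := le_sup_left
    have huv : FreeGroup.mk u * FreeGroup.mk v ∈ K := by
      rw [FreeGroup.mul_mk]
      exact (le_sup_right : _ ≤ K) (Subgroup.mem_zpowers _)
    have hpq : cosetMap hHK p.1 = cosetMap hHK q.1 := by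
      calc cosetMap hHK p.1
          = cosetMap hHK (cosetMul H (FreeGroup.mk u) (Quotient.mk _ 1)) :=
            congrArg _ (stallings_walk H hu).symm
        _ = Quotient.mk _ (1 * FreeGroup.mk u) := rfl
        _ = Quotient.mk _ (1 * (FreeGroup.mk v)⁻¹) := by
            rw [coset_eq_iff]
            simpa using huv
        _ = cosetMul K (FreeGroup.mk v)⁻¹ (cosetMap hHK (Quotient.mk _ 1)) := rfl
        _ = cosetMul K (FreeGroup.mk v)⁻¹ (cosetMap hHK (cosetMul H (FreeGroup.mk v) q.1)) :=
            congrArg (fun c => cosetMul K (FreeGroup.mk v)⁻¹ (cosetMap hHK c))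
              (stallings_walk H hv).symm
        _ = cosetMap hHK q.1 :=
            (congrArg _ (cosetMap_cosetMul hHK _ _)).trans (cosetMul_inv K _ _)
    let φ : ((stallings H).identify p q).V → (schreier K).V :=
      Quot.lift (fun r => cosetMap hHK r.1) (by rintro _ _ ⟨rfl, rfl⟩; exact hpq)
    have hφ : ∀ a x b, ((stallings H).identify p q).Step a x b →
        (schreier K).Step (φ a) x (φ b) := by
      rintro _ _ _ ⟨e, rfl, rfl, rfl⟩
      rw [schreier_step]
      exact (cosetMap_cosetMul hHK _ _).symm
    obtain ⟨w, hw, rfl⟩ := (InvolutiveAutomaton.mem_subgroup _).1 hg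
    exact (schreier_walk_base K).1 (hw.map hφ)
  · refine sup_le (fun g hg => ?_) ?_
    · obtain ⟨w, hw, rfl⟩ := exists_stallings_walk H hg
      exact (InvolutiveAutomaton.mem_subgroup _).2 ⟨w, identify_walk p q hw, rfl⟩
    · rw [Subgroup.zpowers_le, InvolutiveAutomaton.mem_subgroup]
      refine ⟨_, (identify_walk p q hu).append ?_, rfl⟩
      rw [show (Quot.mk _ p : ((stallings H).identify p q).V) = Quot.mk _ q from
        Quot.sound ⟨rfl, rfl⟩]
      exact identify_walk p q hv

/-- The description of the join-cocycles when the Stallings automaton has at least two vertices. -/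
theorem reducedForms_joinCocycles [Nontrivial (stallings H).V] :
    reducedForms (joinCocycles H) =
      (⨆ (p : (stallings H).V) (q : (stallings H).V)
        (_ : ((stallings H).identify p q).reduction.IsBouquet Set.univ),
          (stallings H).lang (stallings H).base p * (stallings H).lang q (stallings H).base) ⊓
        reducedWords α := by
  refine Language.ext fun w => ?_
  have hmem : ∀ (L L' : Language (α × Bool)), w ∈ L ⊓ L' ↔ w ∈ L ∧ w ∈ L' := fun _ _ => Iff.rfl
  rw [hmem]
  simp only [Language.mem_iSup, Language.mem_mul, InvolutiveAutomaton.mem_lang,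
    InvolutiveAutomaton.reduction, stallings_isBouquet_univ]
  change FreeGroup.IsReduced w ∧ H ⊔ Subgroup.zpowers (FreeGroup.mk w) = ⊤ ↔
    _ ∧ FreeGroup.IsReduced w
  rw [and_comm]
  refine and_congr_left fun hw => ?_
  constructor
  · intro h
    obtain ⟨c, hc⟩ := exists_ne (stallings H).base
    obtain ⟨v, hv⟩ := (schreier H).exists_walk_core c
    obtain ⟨x, d, hx, hd⟩ := hv.exists_exit hc
    obtain ⟨u₁, u₂, p, q, rfl, h1, h2⟩ := (stallings_isInverse H).exists_split hx hd
      (fun g hg => exists_stallings_walk H hg) hw (h ▸ Subgroup.mem_top _)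
    exact ⟨p, q, (identify_subgroup H h1 h2).trans h, u₁, h1, u₂, h2, rfl⟩
  · rintro ⟨p, q, h, u₁, h1, u₂, h2, rfl⟩
    rw [← identify_subgroup H h1 h2, h]

end Stallings

/-! ### Subgroups generated by letters -/

section Letters

variable {α : Type*}

/-- The sum of the exponents of a letter. -/
noncomputable def exponentSum (a : α) : FreeGroup α →* Multiplicative ℤ := by
  classical exact FreeGroup.lift fun b => if b = a then Multiplicative.ofAdd 1 else 1

theorem exponentSum_of_self (a : α) :
    exponentSum a (FreeGroup.of a) = Multiplicative.ofAdd 1 := by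
  simp [exponentSum]

theorem exponentSum_of_ne {a b : α} (h : b ≠ a) : exponentSum a (FreeGroup.of b) = 1 := by
  simp [exponentSum, h]

theorem closure_le_ker_exponentSum {a : α} {B : Set α} (ha : a ∉ B) :
    Subgroup.closure (FreeGroup.of '' B) ≤ (exponentSum a).ker := by
  rw [Subgroup.closure_le]
  rintro _ ⟨b, hb, rfl⟩
  exact exponentSum_of_ne fun h => ha (h ▸ hb)

theorem of_notMem_closure {a : α} {B : Set α} (ha : a ∉ B) :
    FreeGroup.of a ∉ Subgroup.closure (FreeGroup.of '' B) := by
  intro h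
  have := closure_le_ker_exponentSum ha h
  rw [MonoidHom.mem_ker, exponentSum_of_self, ofAdd_eq_one] at this
  exact one_ne_zero this

/-- The exponent sums of two missing letters vanish on the closure and together map onto `ℤ²`, so a
cocycle would make `ℤ²` cyclic. -/
theorem joinCocycles_closure_eq_empty {α : Type u} {a b : α} {B : Set α} (ha : a ∉ B) (hb : b ∉ B)
    (hab : a ≠ b) : joinCocycles (Subgroup.closure (FreeGroup.of '' B)) = ∅ := by
  refine Set.eq_empty_iff_forall_notMem.2 fun g (hg : _ = ⊤) => ?_
  let φ := (exponentSum a).prod (exponentSum b)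
  have hle : Subgroup.closure (FreeGroup.of '' B) ⊔ Subgroup.zpowers g ≤
      (Subgroup.zpowers (φ g)).comap φ := by
    refine sup_le (fun h hh => ?_) ?_
    · have h1 : exponentSum a h = 1 := closure_le_ker_exponentSum ha hh
      have h2 : exponentSum b h = 1 := closure_le_ker_exponentSum hb hh
      have : φ h = 1 := by simp [φ, h1, h2]
      rw [Subgroup.mem_comap, this]
      exact one_mem _
    · rw [Subgroup.zpowers_le]
      exact Subgroup.mem_zpowers _
  rw [hg] at hle
  obtain ⟨k, hk⟩ := Subgroup.mem_zpowers_iff.1 (hle (Subgroup.mem_top (FreeGroup.of a)))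
  obtain ⟨l, hl⟩ := Subgroup.mem_zpowers_iff.1 (hle (Subgroup.mem_top (FreeGroup.of b)))
  have hk1 := congrArg (fun z => z.1.toAdd) hk
  have hk2 := congrArg (fun z => z.2.toAdd) hk
  have hl2 := congrArg (fun z => z.2.toAdd) hl
  simp only [φ, Prod.pow_fst, Prod.pow_snd, MonoidHom.prod_apply, toAdd_zpow, smul_eq_mul,
    exponentSum_of_self, exponentSum_of_ne hab, toAdd_ofAdd, toAdd_one] at hk1 hk2 hl2
  -- The powers `k` and `l` of `φ g` are `(1, 0)` and `(0, 1)`. The first forces `k ≠ 0`, the second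
  -- forces the second coordinate of `φ g` to be nonzero, yet their product is zero.
  rcases mul_eq_zero.1 hk2 with h | h
  · simp [h] at hk1
  · simp [h] at hl2

/-- Two vertices `false` and `true`, loops at `false` for all letters but `a`, and an arc from
`false` to `true` labelled `a`. -/
def pendantStep (a : α) (p : Bool) (x : α × Bool) (q : Bool) : Prop :=
  (p = false ∧ q = false ∧ x.1 ≠ a) ∨ (p = false ∧ q = true ∧ x = (a, true)) ∨
    (p = true ∧ q = false ∧ x = (a, false))

theorem pendantStep_isInverse (a : α) : IsInverse (pendantStep a) where
  symm := by
    rintro p ⟨x, b⟩ q (⟨rfl, rfl, h⟩ | ⟨rfl, rfl, h⟩ | ⟨rfl, rfl, h⟩)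
    · exact .inl ⟨rfl, rfl, h⟩
    · cases h; exact .inr (.inr ⟨rfl, rfl, rfl⟩)
    · cases h; exact .inr (.inl ⟨rfl, rfl, rfl⟩)
  det := by
    rintro p ⟨x, b⟩ q r (⟨rfl, rfl, h⟩ | ⟨rfl, rfl, h⟩ | ⟨rfl, rfl, h⟩)
      (⟨h1, rfl, h'⟩ | ⟨h1, rfl, h'⟩ | ⟨h1, rfl, h'⟩) <;> simp_all

/-- The label of the path from `false` to a given vertex. -/
def pendantLabel (a : α) (p : Bool) : FreeGroup α := cond p (FreeGroup.of a) 1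

/-- Corrected by the paths from `false` to its ends, a loop contributes a letter other than `a` or
its inverse, and the pendant arc contributes `1`; along a walk the corrections telescope. -/
theorem pendantLabel_mul_mem {a : α} {p q : Bool} {w : List (α × Bool)}
    (h : Walk (pendantStep a) p w q) :
    pendantLabel a p * FreeGroup.mk w * (pendantLabel a q)⁻¹ ∈
      Subgroup.closure (FreeGroup.of '' ({a}ᶜ : Set α)) := by
  induction w generalizing p with
  | nil =>
    cases h
    simp [mk_nil]
  | cons x w ih =>
    obtain ⟨r, h1, h2⟩ := h
    have := mul_mem (s := Subgroup.closure (FreeGroup.of '' ({a}ᶜ : Set α)))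
      (a := pendantLabel a p * FreeGroup.mk [x] * (pendantLabel a r)⁻¹) ?_ (ih h2)
    · rw [mk_cons]
      convert this using 1
      group
    · rcases h1 with ⟨rfl, rfl, h⟩ | ⟨rfl, rfl, rfl⟩ | ⟨rfl, rfl, rfl⟩
      · have := Subgroup.subset_closure (k := FreeGroup.of '' ({a}ᶜ : Set α)) ⟨x.1, h, rfl⟩
        obtain ⟨x, b⟩ := x
        simpa [pendantLabel] using (mk_single_mem_iff _).2 this
      · have : FreeGroup.mk [(a, true)] = FreeGroup.of a := rfl
        simp [pendantLabel, this]
      · have : FreeGroup.mk [(a, false)] = (FreeGroup.of a)⁻¹ := rfl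
        simp [pendantLabel, this]

/-- The bouquet has no arc leaving its vertex, so `IsInverse.exists_split` is applied after adding
the pendant arc `a`, which does not change the recognized subgroup. -/
theorem joinCocycles_closure_compl_singleton {α : Type} (a : α) :
    joinCocycles (Subgroup.closure (FreeGroup.of '' ({a}ᶜ : Set α))) =
      {g | ∃ u ∈ Subgroup.closure (FreeGroup.of '' ({a}ᶜ : Set α)),
        ∃ v ∈ Subgroup.closure (FreeGroup.of '' ({a}ᶜ : Set α)),
          g = u * FreeGroup.of a * v ∨ g = u * (FreeGroup.of a)⁻¹ * v} := by
  classical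
  set F := Subgroup.closure (FreeGroup.of '' ({a}ᶜ : Set α)) with hF
  have haF : FreeGroup.of a ∉ F := of_notMem_closure fun h => h rfl
  ext g
  constructor
  · intro (hg : F ⊔ Subgroup.zpowers g = ⊤)
    have hle : F ≤ (pendantStep_isInverse a).subgroup false := by
      rw [hF, Subgroup.closure_le]
      rintro _ ⟨b, hb, rfl⟩
      exact ⟨[(b, true)], .single (.inl ⟨rfl, rfl, hb⟩), rfl⟩
    obtain ⟨u₁, u₂, r, s, hu, h1, h2⟩ := (pendantStep_isInverse a).exists_split
      (x := (a, true)) (.inr (.inl ⟨rfl, rfl, rfl⟩)) (by simp) hle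
      (FreeGroup.isReduced_toWord (x := g))
      (by rw [FreeGroup.mk_toWord, hg]; exact Subgroup.mem_top _)
    have hg' : g = FreeGroup.mk u₁ * FreeGroup.mk u₂ := by
      rw [FreeGroup.mul_mk, ← hu, FreeGroup.mk_toWord]
    have m1 := pendantLabel_mul_mem h1
    have m2 := pendantLabel_mul_mem h2
    refine ⟨_, m1, _, m2, ?_⟩
    -- Here `g` is an element of `F`, then `pendantLabel a r * (pendantLabel a s)⁻¹`, then an
    -- element of `F`. If `r = s` then `g ∈ F`, which is proper; otherwise the middle factor is `a`
    -- or its inverse.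
    cases r <;> cases s
    · exfalso
      have hgF : g ∈ F := by
        rw [hg']
        simpa [pendantLabel] using mul_mem m1 m2
      rw [sup_eq_left.2 ((Subgroup.zpowers_le).2 hgF)] at hg
      exact haF (hg ▸ Subgroup.mem_top _)
    · right; simp [pendantLabel, hg', mul_assoc]
    · left; simp [pendantLabel, hg', mul_assoc]
    · exfalso
      have hgF : g ∈ F := by
        rw [hg']
        simpa [pendantLabel, mul_assoc] using mul_mem m1 m2
      rw [sup_eq_left.2 ((Subgroup.zpowers_le).2 hgF)] at hg
      exact haF (hg ▸ Subgroup.mem_top _)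
  · rintro ⟨u, hu, v, hv, hg⟩
    refine eq_top_of_of_mem _ fun b => ?_
    have hle : F ≤ F ⊔ Subgroup.zpowers g := le_sup_left
    have hgm : g ∈ F ⊔ Subgroup.zpowers g :=
      (le_sup_right : _ ≤ F ⊔ Subgroup.zpowers g) (Subgroup.mem_zpowers g)
    by_cases hb : b = a
    · subst hb
      have key := mul_mem (mul_mem (inv_mem (hle hu)) hgm) (inv_mem (hle hv))
      rcases hg with h | h
      · rwa [show u⁻¹ * g * v⁻¹ = FreeGroup.of b by rw [h]; group] at key
      · rw [show u⁻¹ * g * v⁻¹ = (FreeGroup.of b)⁻¹ by rw [h]; group] at key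
        simpa using key
    · exact hle (Subgroup.subset_closure ⟨b, hb, rfl⟩)

/-- With one vertex every arc is a loop at the basepoint, so each letter of a closed walk already
lies in `H`. -/
theorem eq_closure_of_subsingleton {α : Type u} (H : Subgroup (FreeGroup α))
    [Subsingleton (stallings H).V] :
    H = Subgroup.closure (FreeGroup.of '' {a | FreeGroup.of a ∈ H}) := by
  apply le_antisymm
  · intro g hg
    have key : ∀ w p q, Walk (stallings H).Step p w q →
        FreeGroup.mk w ∈ Subgroup.closure (FreeGroup.of '' {a | FreeGroup.of a ∈ H}) := by
      intro w
      induction w with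
      | nil => exact fun _ _ _ => one_mem _
      | cons x w ih =>
        rintro p q ⟨r, ⟨e, -, he, -⟩, h2⟩
        rw [mk_cons]
        refine mul_mem ?_ (ih _ _ h2)
        have hx := (stallings_mem_range_lab H).1 ⟨e, he⟩
        obtain ⟨x, b⟩ := x
        rw [mk_single_mem_iff] at hx ⊢
        exact Subgroup.subset_closure ⟨x, hx, rfl⟩
    obtain ⟨w, hw, rfl⟩ := exists_stallings_walk H hg
    exact key _ _ _ hw
  · rw [Subgroup.closure_le]
    rintro _ ⟨a, ha, rfl⟩
    exact ha

/-- The description of the join-cocycles when the Stallings automaton has a single vertex. -/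
theorem joinCocycles_of_subsingleton {n : ℕ} (H : Subgroup (FreeGroup (Fin n)))
    [Subsingleton (stallings H).V] :
    ∃ B : Set (Fin n), (stallings H).IsBouquet B ∧
      (B = Set.univ → joinCocycles H = Set.univ) ∧
      (∀ a : Fin n, B = {a}ᶜ →
        joinCocycles H =
          {g | ∃ u ∈ Subgroup.closure (FreeGroup.of '' B),
            ∃ v ∈ Subgroup.closure (FreeGroup.of '' B),
              g = u * FreeGroup.of a * v ∨ g = u * (FreeGroup.of a)⁻¹ * v}) ∧
      (B.ncard + 1 < n → joinCocycles H = ∅) := by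
  have hH := eq_closure_of_subsingleton H
  have hB := stallings_isBouquet H
  generalize {a | FreeGroup.of a ∈ H} = B at hH hB
  refine ⟨B, hB, ?_, ?_, ?_⟩
  · rintro rfl
    have : H = ⊤ := by rw [hH, Set.image_univ, FreeGroup.closure_range_of]
    exact Set.eq_univ_of_forall fun g => by simp [joinCocycles, this]
  · rintro a rfl
    rw [hH]
    exact joinCocycles_closure_compl_singleton a
  · intro h
    have := Set.ncard_add_ncard_compl B
    rw [Nat.card_eq_fintype_card, Fintype.card_fin] at this
    obtain ⟨a, b, ha, hb, hab⟩ := (Set.one_lt_ncard_iff (s := Bᶜ)).1 (by omega)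
    rw [hH]
    exact joinCocycles_closure_eq_empty ha hb hab

end Letters

/-! ### Kleene's theorem -/

section Kleene

variable {α : Type u}

theorem IsRationalLanguage.add {L M : Language α} (hL : IsRationalLanguage L)
    (hM : IsRationalLanguage M) : IsRationalLanguage (L + M) := by
  obtain ⟨R, rfl⟩ := hL
  obtain ⟨S, rfl⟩ := hM
  exact ⟨R + S, rfl⟩

theorem IsRationalLanguage.mul {L M : Language α} (hL : IsRationalLanguage L)
    (hM : IsRationalLanguage M) : IsRationalLanguage (L * M) := by
  obtain ⟨R, rfl⟩ := hL
  obtain ⟨S, rfl⟩ := hM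
  exact ⟨R * S, rfl⟩

theorem IsRationalLanguage.kstar {L : Language α} (hL : IsRationalLanguage L) :
    IsRationalLanguage (KStar.kstar L) := by
  obtain ⟨R, rfl⟩ := hL
  exact ⟨R.star, rfl⟩

theorem isRationalLanguage_zero : IsRationalLanguage (0 : Language α) := ⟨0, rfl⟩

theorem isRationalLanguage_one : IsRationalLanguage (1 : Language α) := ⟨1, rfl⟩

theorem IsRationalLanguage.sum {ι : Type*} (s : Finset ι) {L : ι → Language α}
    (h : ∀ i ∈ s, IsRationalLanguage (L i)) : IsRationalLanguage (∑ i ∈ s, L i) :=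
  Finset.sum_induction _ _ (fun _ _ => .add) isRationalLanguage_zero h

theorem mem_finset_sum {ι : Type*} {s : Finset ι} {L : ι → Language α} {w : List α} :
    w ∈ ∑ i ∈ s, L i ↔ ∃ i ∈ s, w ∈ L i := by
  classical
  induction s using Finset.induction_on with
  | empty => simp [Language.notMem_zero]
  | insert i s hi ih => simp [Finset.sum_insert hi, Language.mem_add, ih]

variable {V : Type*} (T : V → α → V → Prop)

open Classical in
/-- The language of the labels of walks of length at most one. -/
noncomputable def shortWalks [Fintype α] (p q : V) : Language α :=
  (if p = q then 1 else 0) + ∑ x : α, if T p x q then {[x]} else 0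

/-- The language of the labels of walks from `p` to `q` whose intermediate vertices are in the
given list. -/
noncomputable def walksVia [Fintype α] : List V → V → V → Language α
  | [], p, q => shortWalks T p q
  | r :: F, p, q => walksVia F p q +
      walksVia F p r * KStar.kstar (walksVia F r r) * walksVia F r q

variable [Fintype α]

theorem isRationalLanguage_walksVia (F : List V) (p q : V) :
    IsRationalLanguage (walksVia T F p q) := by
  induction F generalizing p q with
  | nil =>
    refine .add ?_ (.sum _ fun x _ => ?_)
    · split_ifs
      exacts [isRationalLanguage_one, isRationalLanguage_zero]
    · split_ifs
      exacts [⟨.char x, rfl⟩, isRationalLanguage_zero]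
  | cons r F ih => exact (ih p q).add (((ih p r).mul (ih r r).kstar).mul (ih r q))

theorem walk_of_mem_walksVia {F : List V} {p q : V} {w : List α} (h : w ∈ walksVia T F p q) :
    Walk T p w q := by
  classical
  induction F generalizing p q w with
  | nil =>
    simp only [walksVia, shortWalks, Language.mem_add, mem_finset_sum] at h
    rcases h with h | ⟨x, -, h⟩
    · split_ifs at h with hpq
      · rw [(Language.mem_one _).1 h]
        exact hpq
      · exact absurd h (Language.notMem_zero _)
    · split_ifs at h with hpq
      · rw [show w = [x] from h]
        exact .single hpq
      · exact absurd h (Language.notMem_zero _)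
  | cons r F ih =>
    rcases (Language.mem_add _ _ _).1 h with h | h
    · exact ih h
    · obtain ⟨_, ⟨a, ha, b, hb, rfl⟩, c, hc, rfl⟩ := h
      refine ((ih ha).append ?_).append (ih hc)
      obtain ⟨L, rfl, hL⟩ := hb
      clear h
      induction L with
      | nil => rfl
      | cons y L ihL =>
        rw [List.flatten_cons]
        exact (ih (hL y (by simp))).append (ihL fun z hz => hL z (by simp [hz]))

theorem shortWalks_le_walksVia (F : List V) (p q : V) : shortWalks T p q ≤ walksVia T F p q := by
  induction F with
  | nil => exact le_rfl
  | cons r F ih => exact ih.trans le_self_add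

/-- This closure under concatenation at listed vertices is what makes the recursion complete. It is
pure Kleene algebra: excursions from `s` back to `s` are absorbed by the star at `s`. -/
theorem walksVia_mul_le {F : List V} {r : V} (hr : r ∈ F) (p q : V) :
    walksVia T F p r * walksVia T F r q ≤ walksVia T F p q := by
  induction F generalizing p q r with
  | nil => cases hr
  | cons s F ih =>
    have hs : ∀ p, walksVia T (s :: F) p s ≤ walksVia T F p s * KStar.kstar (walksVia T F s s) := by
      intro p
      refine add_le (le_mul_of_one_le_right' one_le_kstar) ?_
      rw [mul_assoc]
      exact mul_le_mul_right kstar_mul_le_kstar _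
    have hs' : ∀ q, walksVia T (s :: F) s q ≤ KStar.kstar (walksVia T F s s) * walksVia T F s q := by
      intro q
      refine add_le (le_mul_of_one_le_left' one_le_kstar) ?_
      exact mul_le_mul_left mul_kstar_le_kstar _
    rcases List.mem_cons.1 hr with rfl | hr
    · refine (mul_le_mul' (hs p) (hs' q)).trans ?_
      rw [mul_assoc, ← mul_assoc (KStar.kstar _), kstar_mul_kstar, ← mul_assoc]
      exact le_add_self
    · simp only [walksVia, add_mul, mul_add]
      set a := walksVia T F p r
      set b := walksVia T F r q
      set c := walksVia T F p s
      set d := KStar.kstar (walksVia T F s s)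
      set e := walksVia T F s r
      set f := walksVia T F r s
      set g := walksVia T F s q
      have h1 : a * b ≤ walksVia T F p q := ih hr _ _
      have h2 : a * f ≤ c := ih hr _ _
      have h3 : e * b ≤ g := ih hr _ _
      have h4 : e * f ≤ d := (ih hr _ _).trans le_kstar
      refine add_le (add_le (h1.trans le_self_add) ?_) (add_le ?_ ?_)
      · rw [mul_assoc]
        exact (mul_le_mul_right h3 _).trans le_add_self
      · calc a * (f * d * g) = (a * f) * (d * g) := by simp only [mul_assoc]
          _ ≤ c * (d * g) := mul_le_mul_left h2 _
          _ = c * d * g := (mul_assoc _ _ _).symm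
          _ ≤ _ := le_add_self
      · calc c * d * e * (f * d * g) = c * (d * (e * f) * d) * g := by simp only [mul_assoc]
          _ ≤ c * (d * d * d) * g :=
            mul_le_mul_left (mul_le_mul_right (mul_le_mul_left (mul_le_mul_right h4 _) _) _) _
          _ = c * d * g := by simp only [d, kstar_mul_kstar]
          _ ≤ _ := le_add_self

theorem mem_walksVia_of_walk {F : List V} (hF : ∀ v, v ∈ F) {p q : V} {w : List α}
    (h : Walk T p w q) : w ∈ walksVia T F p q := by
  classical
  induction w generalizing p with
  | nil =>
    cases h
    refine shortWalks_le_walksVia T F _ _ ?_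
    rw [shortWalks, if_pos rfl]
    exact (Language.mem_add _ _ _).2 (.inl Language.nil_mem_one)
  | cons x w ih =>
    obtain ⟨r, h1, h2⟩ := h
    refine walksVia_mul_le T (hF r) p q ?_
    refine ⟨[x], shortWalks_le_walksVia T F p r ?_, w, ih h2, rfl⟩
    refine (Language.mem_add _ _ _).2 (.inr (mem_finset_sum.2 ⟨x, Finset.mem_univ _, ?_⟩))
    rw [if_pos h1]
    rfl

/-- The language of the labels of the walks between two sets of vertices of a finite transition
relation over a finite alphabet is rational. -/
theorem isRationalLanguage_walks [Finite V] (I J : V → Prop) :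
    IsRationalLanguage {w | ∃ p q, I p ∧ J q ∧ Walk T p w q} := by
  classical
  have := Fintype.ofFinite V
  have hL := IsRationalLanguage.sum (Finset.univ.filter fun z : V × V => I z.1 ∧ J z.2)
    (fun z _ => isRationalLanguage_walksVia T Finset.univ.toList z.1 z.2)
  refine (congrArg IsRationalLanguage (Language.ext fun w => ?_)).mpr hL
  simp only [mem_finset_sum, Finset.mem_filter, Finset.mem_univ, true_and, Prod.exists]
  constructor
  · rintro ⟨p, q, h1, h2, h⟩
    exact ⟨p, q, ⟨h1, h2⟩, mem_walksVia_of_walk T (by simp) h⟩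
  · rintro ⟨p, q, ⟨h1, h2⟩, h⟩
    exact ⟨p, q, h1, h2, walk_of_mem_walksVia T h⟩

end Kleene

/-! ### Membership in finitely generated subgroups -/

/-- A set of group elements that contains `S`, and is closed under those right divisions whose
result has norm at most `2 * L`, contains all elements of norm at most `L` of the subgroup generated
by `S`, provided that the elements of `S` have norm at most `L`. -/
theorem mem_of_mem_closure_of_locally_closed {α : Type*} [DecidableEq α] {S : Set (FreeGroup α)}
    {L : ℕ} (hS : ∀ s ∈ S, s.norm ≤ L) {N : Set (FreeGroup α)} (h1 : 1 ∈ N) (hSN : S ⊆ N)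
    (hN : ∀ g ∈ N, ∀ h ∈ N, (g * h⁻¹).norm ≤ 2 * L → g * h⁻¹ ∈ N) {g : FreeGroup α}
    (hg : g ∈ Subgroup.closure S) (hgL : g.norm ≤ L) : g ∈ N := by
  have hnorm : ∀ a b : {g : FreeGroup α // g.norm ≤ L}, (a.1 * b.1⁻¹).norm ≤ 2 * L := by
    intro a b
    have := FreeGroup.norm_mul_le a.1 b.1⁻¹
    rw [FreeGroup.norm_inv_eq] at this
    have := a.2
    have := b.2
    omega
  have hsymm : ∀ a b : {g : FreeGroup α // g.norm ≤ L}, a.1 * b.1⁻¹ ∈ N → b.1 * a.1⁻¹ ∈ N := by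
    intro a b h
    have := hN 1 h1 _ h
    rw [show 1 * (a.1 * b.1⁻¹)⁻¹ = b.1 * a.1⁻¹ by group] at this
    exact this (hnorm b a)
  -- Two elements of the ball of radius `L` have a quotient of norm at most `2 * L`, so local
  -- closure of `N` gives symmetry and transitivity. The classes imitate cosets, and `T` below is
  -- the ball of the Cayley graph folded along them.
  let E : Setoid {g : FreeGroup α // g.norm ≤ L} :=
    { r := fun a b => a.1 * b.1⁻¹ ∈ N
      iseqv :=
        { refl := fun a => by simpa using h1
          symm := fun {a b} h => hsymm a b h
          trans := fun {a b c} h h' => by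
            have := hN _ h _ (hsymm _ _ h')
            rw [show a.1 * b.1⁻¹ * (c.1 * b.1⁻¹)⁻¹ = a.1 * c.1⁻¹ by group] at this
            exact this (hnorm a c) } }
  have hE : ∀ a b : {g : FreeGroup α // g.norm ≤ L},
      Quotient.mk E a = Quotient.mk E b ↔ a.1 * b.1⁻¹ ∈ N := fun a b => Quotient.eq
  let T : Quotient E → α × Bool → Quotient E → Prop := fun P x Q =>
    ∃ a b, P = Quotient.mk E a ∧ Q = Quotient.mk E b ∧ a.1 * FreeGroup.mk [x] = b.1
  have hT : IsInverse T :=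
    { symm := by
        rintro _ x _ ⟨a, b, rfl, rfl, h⟩
        refine ⟨b, a, rfl, rfl, ?_⟩
        rw [mk_letterInv, ← h]
        group
      det := by
        rintro _ x _ _ ⟨a, b, rfl, rfl, h⟩ ⟨a', b', h1, rfl, h'⟩
        rw [hE] at h1 ⊢
        rwa [← h, ← h', show a.1 * FreeGroup.mk [x] * (a'.1 * FreeGroup.mk [x])⁻¹ = a.1 * a'.1⁻¹
          by group] }
  have hwalk : ∀ (w u : List (α × Bool)) (h : (FreeGroup.mk u).norm ≤ L)
      (h' : (FreeGroup.mk (u ++ w)).norm ≤ L), u.length + w.length ≤ L →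
      Walk T (Quotient.mk E ⟨FreeGroup.mk u, h⟩) w (Quotient.mk E ⟨FreeGroup.mk (u ++ w), h'⟩) := by
    intro w
    induction w with
    | nil =>
      intro u h h' _
      simp [Walk]
    | cons x w ih =>
      intro u h h' hl
      rw [List.length_cons] at hl
      have hx : (FreeGroup.mk (u ++ [x])).norm ≤ L := by
        refine FreeGroup.norm_mk_le.trans ?_
        rw [List.length_append, List.length_singleton]
        omega
      refine ⟨Quotient.mk E ⟨FreeGroup.mk (u ++ [x]), hx⟩, ⟨_, _, rfl, rfl, ?_⟩, ?_⟩
      · rw [FreeGroup.mul_mk]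
      · have := ih (u ++ [x]) hx (by simpa using h')
          (by rw [List.length_append, List.length_singleton]; omega)
        simpa using this
  let b : Quotient E := Quotient.mk E ⟨1, by simp⟩
  have hread : ∀ g : FreeGroup α, ∀ h : g.norm ≤ L,
      Walk T b g.toWord (Quotient.mk E ⟨g, h⟩) := by
    intro g h
    have := hwalk g.toWord [] (by simp [mk_nil])
      (by rwa [List.nil_append, FreeGroup.mk_toWord]) (by rwa [List.length_nil, zero_add])
    simpa only [List.nil_append, FreeGroup.mk_toWord, mk_nil] using this
  -- The word of `s` leads from the class of `1` to the class of `s`, which is the same class since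
  -- `s ∈ N`.
  have hle : Subgroup.closure S ≤ hT.subgroup b := by
    rw [Subgroup.closure_le]
    intro s hs
    refine ⟨s.toWord, ?_, FreeGroup.mk_toWord⟩
    have := hread s (hS s hs)
    rwa [(hE ⟨s, hS s hs⟩ ⟨1, by simp⟩).2 (by simpa using hSN hs)] at this
  have hgb := hT.walk_of_mem_subgroup FreeGroup.isReduced_toWord
    (by rw [FreeGroup.mk_toWord]; exact hle hg)
  -- The reduced word of `g` leads to the class of `g` and also closes up at the class of `1`;
  -- determinism gives `g ∈ N`.
  simpa using (hE _ _).1 (hT.walk_det (hread g hgL) hgb)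

/-! ### The saturation algorithm on lists of words -/

/-- The iterates form an increasing chain of sublists. Without a repetition in the first `K + 1`
steps, the length would exceed `K`. -/
theorem iterate_eq_of_sublist {β : Type*} (f : List β → List β) (K : ℕ)
    (hf : ∀ a b, a.Sublist b → (f a).Sublist (f b)) (hK : ∀ a, (f a).length ≤ K) :
    f (f^[K] []) = f^[K] [] := by
  have hchain : ∀ k, (f^[k] []).Sublist (f^[k + 1] []) := by
    intro k
    induction k with
    | zero => exact List.nil_sublist _
    | succ k ih =>
      rw [Function.iterate_succ_apply', Function.iterate_succ_apply' f (k + 1)]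
      exact hf _ _ ih
  by_contra hne
  have hstep : ∀ k, k ≤ K → f^[k + 1] [] ≠ f^[k] [] := by
    intro k hk h
    apply hne
    obtain ⟨m, rfl⟩ := Nat.exists_eq_add_of_le hk
    have : ∀ m, f^[k + m] [] = f^[k] [] := by
      intro m
      induction m with
      | zero => rfl
      | succ m ih => rw [← add_assoc, Function.iterate_succ_apply', ih,
          ← Function.iterate_succ_apply' f, h]
    rw [this, ← Function.iterate_succ_apply' f, h]
  have hlen : ∀ k, k ≤ K + 1 → k ≤ (f^[k] []).length := by
    intro k
    induction k with
    | zero => simp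
    | succ k ih =>
      intro hk
      by_contra hlt
      have h1 := (hchain k).length_le
      have h2 := ih (by omega)
      exact hstep k (by omega) ((hchain k).eq_of_length (by omega)).symm
  have h1 := hlen (K + 1) le_rfl
  rw [Function.iterate_succ_apply'] at h1
  have h2 := hK (f^[K] [])
  omega

/-- Words over the involutive closure of the letters `0, 1, …`. -/
abbrev NatWord : Type := List (ℕ × Bool)

/-- The list of the letters with index less than `n`, and their inverses. -/
def letters (n : ℕ) : List (ℕ × Bool) :=
  (List.range n).flatMap fun i => [(i, true), (i, false)]

/-- The list of the words of length at most `k` in the letters with index less than `n`. -/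
def ball (n k : ℕ) : List NatWord :=
  (fun B => [] :: B.flatMap fun w => (letters n).map fun x => x :: w)^[k] [[]]

theorem mem_letters {n : ℕ} {x : ℕ × Bool} : x ∈ letters n ↔ x.1 < n := by
  obtain ⟨i, b⟩ := x
  cases b <;> simp [letters]

theorem mem_ball {n k : ℕ} {w : NatWord} : w ∈ ball n k ↔ w.length ≤ k ∧ ∀ x ∈ w, x.1 < n := by
  induction k generalizing w with
  | zero =>
    simp only [ball, Function.iterate_zero, id, List.mem_singleton, nonpos_iff_eq_zero,
      List.length_eq_zero_iff]
    constructor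
    · rintro rfl; simp
    · exact fun h => h.1
  | succ k ih =>
    rw [ball, Function.iterate_succ_apply', ← ball]
    cases w with
    | nil => simp
    | cons x w =>
      simp only [List.mem_cons, reduceCtorEq, List.mem_flatMap, List.mem_map, false_or, ih,
        List.cons.injEq, mem_letters, List.length_cons, forall_eq_or_imp]
      constructor
      · rintro ⟨a, ⟨h1, h2⟩, y, hy, rfl, rfl⟩
        exact ⟨by omega, hy, h2⟩
      · rintro ⟨h1, h2, h3⟩
        exact ⟨w, ⟨by omega, h3⟩, x, h2, rfl, rfl⟩

/-- One round of closing a list of words, within a list `B`, under right division. -/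
def divisionStep (S B N : List NatWord) : List NatWord :=
  B.filter fun w => w = [] ∨ w ∈ S ∨
    ∃ u ∈ N, ∃ v ∈ N, FreeGroup.reduce (u ++ FreeGroup.invRev v) = FreeGroup.reduce w

/-- The result of closing the empty list under right division within a list `B`. -/
def divisionClosure (S B : List NatWord) : List NatWord :=
  (divisionStep S B)^[B.length] []

theorem divisionStep_divisionClosure (S B : List NatWord) :
    divisionStep S B (divisionClosure S B) = divisionClosure S B := by
  refine iterate_eq_of_sublist _ _ (fun M N h => ?_) fun N => List.length_filter_le _ _
  refine List.monotone_filter_right _ fun w => ?_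
  simp only [decide_eq_true_eq]
  refine Or.imp_right (Or.imp_right ?_)
  rintro ⟨u, hu, v, hv, huv⟩
  exact ⟨u, h.subset hu, v, h.subset hv, huv⟩

theorem mem_divisionClosure {S B : List NatWord} {w : NatWord} : w ∈ divisionClosure S B ↔
    w ∈ B ∧ (w = [] ∨ w ∈ S ∨ ∃ u ∈ divisionClosure S B, ∃ v ∈ divisionClosure S B,
      FreeGroup.reduce (u ++ FreeGroup.invRev v) = FreeGroup.reduce w) := by
  conv_lhs => rw [← divisionStep_divisionClosure]
  simp [divisionStep]

/-- The membership test: `w` is recognised as an element of the subgroup generated by `S`. -/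
def MemGenerated (n : ℕ) (S : List NatWord) (w : NatWord) : Prop :=
  w ∈ divisionClosure S (ball n (2 * (S.flatten.length + w.length)))

section Encode

variable {n : ℕ}

theorem mk_encodeWord (w : List (Fin n × Bool)) :
    FreeGroup.mk (encodeWord w) = FreeGroup.map Fin.val (FreeGroup.mk w) :=
  FreeGroup.map.mk.symm

theorem encodeWord_injective : Function.Injective (encodeWord (n := n)) := by
  refine List.map_injective_iff.2 ?_
  rintro ⟨i, b⟩ ⟨j, c⟩ h
  simpa [Fin.ext_iff] using h

@[simp] theorem encodeWord_append (u v : List (Fin n × Bool)) :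
    encodeWord (u ++ v) = encodeWord u ++ encodeWord v := List.map_append

theorem encodeWord_invRev (u : List (Fin n × Bool)) :
    encodeWord (FreeGroup.invRev u) = FreeGroup.invRev (encodeWord u) := by
  simp [encodeWord, FreeGroup.invRev, Function.comp_def]

@[simp] theorem length_encodeWord (u : List (Fin n × Bool)) :
    (encodeWord u).length = u.length := List.length_map _

theorem exists_encodeWord_eq_iff {w : NatWord} :
    (∃ u : List (Fin n × Bool), encodeWord u = w) ↔ ∀ x ∈ w, x.1 < n := by
  constructor
  · rintro ⟨u, rfl⟩ x hx
    obtain ⟨y, -, rfl⟩ := List.mem_map.1 hx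
    exact y.1.2
  · intro h
    induction w with
    | nil => exact ⟨[], rfl⟩
    | cons x w ih =>
      obtain ⟨u, rfl⟩ := ih fun y hy => h y (by simp [hy])
      exact ⟨(⟨x.1, h x (by simp)⟩, x.2) :: u, rfl⟩

theorem encodeWord_mem_ball {k : ℕ} {w : List (Fin n × Bool)} :
    encodeWord w ∈ ball n k ↔ w.length ≤ k := by
  rw [mem_ball, ← exists_encodeWord_eq_iff]
  simp

theorem exists_of_mem_ball {k : ℕ} {w : NatWord} (h : w ∈ ball n k) :
    ∃ u : List (Fin n × Bool), encodeWord u = w :=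
  exists_encodeWord_eq_iff.2 (mem_ball.1 h).2

theorem reduce_encodeWord_eq_iff {u v : List (Fin n × Bool)} :
    FreeGroup.reduce (encodeWord u) = FreeGroup.reduce (encodeWord v) ↔
      FreeGroup.mk u = FreeGroup.mk v := by
  rw [← FreeGroup.toWord_mk, ← FreeGroup.toWord_mk, FreeGroup.toWord_inj, mk_encodeWord,
    mk_encodeWord]
  exact (FreeGroup.map_injective Fin.val_injective).eq_iff

theorem mk_append_invRev {α : Type*} (u v : List (α × Bool)) :
    (FreeGroup.mk (u ++ FreeGroup.invRev v) : FreeGroup α) =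
      FreeGroup.mk u * (FreeGroup.mk v)⁻¹ := by
  rw [FreeGroup.inv_mk, FreeGroup.mul_mk]

/-- The subgroup generated by the values of a list of words. -/
def generated {α : Type*} (S : List (List (α × Bool))) : Subgroup (FreeGroup α) :=
  Subgroup.closure {g | ∃ s ∈ S, FreeGroup.mk s = g}

theorem generated_cons {α : Type*} (s : List (α × Bool)) (S : List (List (α × Bool))) :
    generated (s :: S) = generated S ⊔ Subgroup.zpowers (FreeGroup.mk s) := by
  rw [generated, generated, sup_comm, Subgroup.zpowers_eq_closure, ← Subgroup.closure_union]
  congr 1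
  ext g
  simp [eq_comm]

theorem mk_mem_generated {α : Type*} {S : List (List (α × Bool))} {s : List (α × Bool)}
    (h : s ∈ S) : FreeGroup.mk s ∈ generated S := Subgroup.subset_closure ⟨s, h, rfl⟩

theorem mk_mem_of_encodeWord_mem_iterate {S : List (List (Fin n × Bool))} {B : List NatWord}
    (k : ℕ) (hB : ∀ w ∈ B, ∃ u : List (Fin n × Bool), encodeWord u = w)
    {w : List (Fin n × Bool)}
    (h : encodeWord w ∈ (divisionStep (S.map encodeWord) B)^[k] []) :
    FreeGroup.mk w ∈ generated S := by
  induction k generalizing w with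
  | zero => simp at h
  | succ k ih =>
    rw [Function.iterate_succ_apply'] at h
    have hsub : ∀ u ∈ (divisionStep (S.map encodeWord) B)^[k] [], u ∈ B := by
      intro u hu
      cases k with
      | zero => simp at hu
      | succ k =>
        rw [Function.iterate_succ_apply'] at hu
        exact (List.mem_filter.1 hu).1
    obtain ⟨-, h⟩ := List.mem_filter.1 h
    rw [decide_eq_true_eq] at h
    rcases h with h | h | ⟨u, hu, v, hv, h⟩
    · rw [show w = [] from List.map_eq_nil_iff.1 h]
      exact one_mem _
    · obtain ⟨s, hs, he⟩ := List.mem_map.1 h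
      rw [← encodeWord_injective he]
      exact mk_mem_generated hs
    · obtain ⟨u, rfl⟩ := hB _ (hsub u hu)
      obtain ⟨v, rfl⟩ := hB _ (hsub v hv)
      rw [← encodeWord_invRev, ← encodeWord_append, reduce_encodeWord_eq_iff,
        mk_append_invRev] at h
      rw [← h]
      exact mul_mem (ih hu) (inv_mem (ih hv))

/-- Soundness holds round by round. For completeness, the total length `L` of `S` and `w` bounds
every generator and `w`, and the saturated ball has the radius `2 * L` required by
`mem_of_mem_closure_of_locally_closed`. -/
theorem memGenerated_iff {S : List (List (Fin n × Bool))} {w : List (Fin n × Bool)} :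
    MemGenerated n (S.map encodeWord) (encodeWord w) ↔ FreeGroup.mk w ∈ generated S := by
  constructor
  · exact mk_mem_of_encodeWord_mem_iterate _ fun _ => exists_of_mem_ball
  · intro h
    rw [MemGenerated]
    have hlen : ∀ s ∈ S, s.length ≤ (S.map encodeWord).flatten.length := by
      intro s hs
      rw [List.length_flatten, List.map_map]
      exact List.le_sum_of_mem (List.mem_map.2 ⟨s, hs, length_encodeWord s⟩)
    set L := (S.map encodeWord).flatten.length + (encodeWord w).length with hL
    set N := divisionClosure (S.map encodeWord) (ball n (2 * L)) with hN
    have hnil : [] ∈ N := mem_divisionClosure.2 ⟨mem_ball.2 (by simp), .inl rfl⟩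
    have hdiv : ∀ u v t : List (Fin n × Bool), encodeWord u ∈ N → encodeWord v ∈ N →
        t.length ≤ 2 * L → FreeGroup.mk u * (FreeGroup.mk v)⁻¹ = FreeGroup.mk t →
        encodeWord t ∈ N := by
      intro u v t hu hv ht h
      refine mem_divisionClosure.2 ⟨encodeWord_mem_ball.2 ht, .inr (.inr ⟨_, hu, _, hv, ?_⟩)⟩
      rw [← encodeWord_invRev, ← encodeWord_append, reduce_encodeWord_eq_iff, mk_append_invRev, h]
    have hwL : w.length ≤ L := by rw [hL, length_encodeWord]; omega
    obtain ⟨u, hu, huw⟩ := mem_of_mem_closure_of_locally_closed (L := L)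
      (N := {g | ∃ u, encodeWord u ∈ N ∧ FreeGroup.mk u = g})
      (by
        rintro _ ⟨s, hs, rfl⟩
        exact FreeGroup.norm_mk_le.trans ((hlen s hs).trans (by omega)))
      ⟨[], hnil, rfl⟩
      (by
        rintro _ ⟨s, hs, rfl⟩
        refine ⟨s, mem_divisionClosure.2 ⟨encodeWord_mem_ball.2 ?_, .inr (.inl ?_)⟩, rfl⟩
        · have := hlen s hs
          omega
        · exact List.mem_map_of_mem hs)
      (by
        rintro _ ⟨u, hu, rfl⟩ _ ⟨v, hv, rfl⟩ hg
        exact ⟨FreeGroup.toWord _, hdiv u v _ hu hv hg FreeGroup.mk_toWord.symm,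
          FreeGroup.mk_toWord⟩)
      h (FreeGroup.norm_mk_le.trans hwL)
    -- Some word with the value of `w` has been found, not necessarily `w`; division by `[]` passes
    -- to `w` itself.
    exact hdiv u [] w hu hnil (by omega) (by simp [huw, mk_nil])

end Encode

/-! ### Primitive recursiveness of the membership test -/

section Primrec

open Primrec

variable {α β γ : Type*} [Primcodable α] [Primcodable β] [Primcodable γ]

theorem primrecPred_exists_mem {f : γ → List α} {R : γ → α → Prop} (hf : Primrec f)
    (hR : PrimrecRel R) : PrimrecPred fun c => ∃ a ∈ f c, R c a :=
  (PrimrecRel.exists_mem_list (R := fun a c => R c a) (hR.comp snd fst)).comp hf .id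

theorem primrecPred_forall_mem {f : γ → List α} {R : γ → α → Prop} (hf : Primrec f)
    (hR : PrimrecRel R) : PrimrecPred fun c => ∀ a ∈ f c, R c a :=
  (PrimrecRel.forall_mem_list (R := fun a c => R c a) (hR.comp snd fst)).comp hf .id

theorem primrecPred_mem {f : γ → List α} {g : γ → α} (hf : Primrec f) (hg : Primrec g) :
    PrimrecPred fun c => g c ∈ f c :=
  (primrecPred_exists_mem hf (R := fun c a => a = g c)
    (Primrec.eq.comp snd (hg.comp fst))).of_eq fun c => by simp

theorem primrec_filter {f : γ → List α} {R : γ → α → Prop} [∀ c, DecidablePred (R c)]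
    (hf : Primrec f) (hR : PrimrecRel R) : Primrec fun c => (f c).filter fun a => R c a :=
  (PrimrecRel.listFilter (R := fun a c => R c a) (hR.comp snd fst)).comp hf .id

theorem primrec_letterInv : Primrec (letterInv : ℕ × Bool → ℕ × Bool) :=
  fst.pair (Primrec.not.comp snd)

theorem primrec_invRev : Primrec (FreeGroup.invRev : NatWord → NatWord) :=
  list_reverse.comp (list_map .id (primrec_letterInv.comp snd).to₂)

/-- Reduction is a right fold: each letter cancels the head of the reduced tail or is put in front
of it. -/
theorem primrec_reduce : Primrec (FreeGroup.reduce : NatWord → NatWord) := by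
  have h : Primrec fun p : NatWord × (ℕ × Bool) × NatWord =>
      (List.casesOn p.2.2 [p.2.1] fun hd tl =>
        if p.2.1.1 = hd.1 ∧ p.2.1.2 = not hd.2 then tl else p.2.1 :: hd :: tl : NatWord) := by
    have hs : Primrec fun p : NatWord × (ℕ × Bool) × NatWord => ([p.2.1] : NatWord) :=
      list_cons.comp (fst.comp snd) (const [])
    refine list_casesOn (f := fun p : NatWord × (ℕ × Bool) × NatWord => p.2.2)
      (h := fun p q => if p.2.1.1 = q.1.1 ∧ p.2.1.2 = not q.1.2 then q.2 else p.2.1 :: q.1 :: q.2)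
      (snd.comp snd) hs ?_
    have hx : Primrec fun q : (NatWord × (ℕ × Bool) × NatWord) × (ℕ × Bool) × NatWord =>
      q.1.2.1 := fst.comp (snd.comp fst)
    have hd : Primrec fun q : (NatWord × (ℕ × Bool) × NatWord) × (ℕ × Bool) × NatWord =>
      q.2.1 := fst.comp snd
    have tl : Primrec fun q : (NatWord × (ℕ × Bool) × NatWord) × (ℕ × Bool) × NatWord =>
      q.2.2 := snd.comp snd
    exact Primrec.ite
      ((Primrec.eq.comp (fst.comp hx) (fst.comp hd)).and
        (Primrec.eq.comp (snd.comp hx) (Primrec.not.comp (snd.comp hd))))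
      tl (list_cons.comp hx (list_cons.comp hd tl))
  refine (list_foldr .id (const []) h.to₂).of_eq fun w => ?_
  induction w with
  | nil => rfl
  | cons x w ih =>
    rw [FreeGroup.reduce.cons, ← ih]
    rfl

theorem primrec_letters : Primrec letters := by
  have h : Primrec₂ fun (_ i : ℕ) => ([(i, true), (i, false)] : List (ℕ × Bool)) :=
    list_cons.comp (snd.pair (const true)) (list_cons.comp (snd.pair (const false)) (const []))
  exact list_flatMap list_range h

theorem primrec_ball : Primrec₂ ball := by
  have h : Primrec₂ fun (a : ℕ × ℕ) (B : List NatWord) =>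
      ([] :: B.flatMap fun w => (letters a.1).map fun x => x :: w : List NatWord) := by
    refine list_cons.comp (const []) (list_flatMap snd ?_)
    refine list_map (primrec_letters.comp (fst.comp (fst.comp fst))) ?_
    exact list_cons.comp snd (snd.comp fst)
  exact nat_iterate snd (const [[]]) h

theorem primrec_divisionStep :
    Primrec₂ fun (a : List NatWord × List NatWord) N => divisionStep a.1 a.2 N := by
  refine primrec_filter (snd.comp fst) ?_
  refine PrimrecPred.or (Primrec.eq.comp snd (const [])) (.or ?_ ?_)
  · exact primrecPred_mem (fst.comp (fst.comp fst)) snd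
  · refine primrecPred_exists_mem (snd.comp fst) ?_
    refine primrecPred_exists_mem (snd.comp (fst.comp fst)) ?_
    refine Primrec.eq.comp (primrec_reduce.comp (list_append.comp (snd.comp fst)
      (primrec_invRev.comp snd))) (primrec_reduce.comp (snd.comp (fst.comp fst)))

theorem primrec_divisionClosure : Primrec₂ divisionClosure :=
  nat_iterate (list_length.comp snd) (const []) primrec_divisionStep

theorem primrecPred_memGenerated {f : γ → ℕ} {g : γ → List NatWord} {h : γ → NatWord}
    (hf : Primrec f) (hg : Primrec g) (hh : Primrec h) :
    PrimrecPred fun c => MemGenerated (f c) (g c) (h c) :=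
  primrecPred_mem (primrec_divisionClosure.comp hg (primrec_ball.comp hf
    (nat_mul.comp (const 2) (nat_add.comp (list_length.comp (list_flatten.comp hg))
      (list_length.comp hh))))) hh

end Primrec

/-! ### Automata as data -/

section Code

theorem mem_evalFrom_iff_walk {β σ : Type*} (M : NFA β σ) {I : Set σ} {w : List β} {t : σ} :
    t ∈ M.evalFrom I w ↔ ∃ s ∈ I, Walk (fun a x b => b ∈ M.step a x) s w t := by
  induction w generalizing I with
  | nil => simp [Walk]
  | cons x w ih =>
    rw [NFA.evalFrom_cons, ih]
    simp only [NFA.mem_stepSet, Walk]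
    constructor
    · rintro ⟨s, ⟨r, hr, h⟩, h'⟩
      exact ⟨r, hr, s, h, h'⟩
    · rintro ⟨r, hr, s, h, h'⟩
      exact ⟨s, ⟨r, hr, h⟩, h'⟩

theorem mem_accepts_iff_walk {β σ : Type*} (M : NFA β σ) {w : List β} :
    w ∈ M.accepts ↔
      ∃ s t, s ∈ M.start ∧ t ∈ M.accept ∧ Walk (fun a x b => b ∈ M.step a x) s w t := by
  rw [NFA.mem_accepts]
  simp only [mem_evalFrom_iff_walk]
  constructor
  · rintro ⟨t, ht, s, hs, h⟩
    exact ⟨s, t, hs, ht, h⟩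
  · rintro ⟨s, t, hs, ht, h⟩
    exact ⟨t, ht, s, hs, h⟩

theorem walk_map {β γ V : Type*} {T : V → γ → V → Prop} (f : β → γ) {p q : V} {w : List β} :
    Walk T p (w.map f) q ↔ Walk (fun a x b => T a (f x) b) p w q := by
  induction w generalizing p with
  | nil => rfl
  | cons x w ih => simp only [List.map_cons, Walk, ih]

variable {σ : Type}

/-- The list of the triples formed by two states and a letter. -/
def triples (Q : List σ) (X : List (ℕ × Bool)) : List (σ × (ℕ × Bool) × σ) :=
  Q.flatMap fun s => X.flatMap fun x => Q.map fun t => (s, x, t)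

theorem mem_triples {Q : List σ} {X : List (ℕ × Bool)} {z : σ × (ℕ × Bool) × σ} :
    z ∈ triples Q X ↔ z.1 ∈ Q ∧ z.2.1 ∈ X ∧ z.2.2 ∈ Q := by
  obtain ⟨s, x, t⟩ := z
  simp only [triples, List.mem_flatMap, List.mem_map, Prod.mk.injEq]
  constructor
  · rintro ⟨s, hs, x, hx, t, ht, rfl, rfl, rfl⟩
    exact ⟨hs, hx, ht⟩
  · rintro ⟨hs, hx, ht⟩
    exact ⟨s, hs, x, hx, t, ht, rfl, rfl, rfl⟩

variable [Encodable σ]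

open Classical in
/-- The description of the automaton with the given list of states, alphabet, initial state,
transition relation and set of final states. -/
noncomputable def automatonCode (Q : List σ) (X : List (ℕ × Bool)) (s : σ)
    (P : σ × (ℕ × Bool) × σ → Prop) (F : σ → Prop) : AutomatonCode :=
  ((Q.map Encodable.encode).foldr (· + ·) 0 + 1, [Encodable.encode s],
    ((triples Q X).filter fun z => P z).map
      (fun z => (Encodable.encode z.1, z.2.1, Encodable.encode z.2.2)),
    (Q.filter fun t => F t).map Encodable.encode)

/-- The number of states is the sum of all codes plus one, a crude bound; the surplus states carry
no transitions. -/
theorem encode_lt_automatonCode {Q : List σ} {X : List (ℕ × Bool)} {s : σ}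
    {P : σ × (ℕ × Bool) × σ → Prop} {F : σ → Prop} {t : σ} (ht : t ∈ Q) :
    Encodable.encode t < (automatonCode Q X s P F).1 := by
  have : Encodable.encode t ≤ (Q.map Encodable.encode).sum :=
    List.le_sum_of_mem (List.mem_map_of_mem ht)
  exact Nat.lt_succ_of_le this

/-- By `hP`, walks from `s` never leave the listed states and letters, so truncation to the lists
loses nothing. -/
theorem mem_accepts_automatonCode {Q : List σ} {X : List (ℕ × Bool)} {s : σ}
    {P : σ × (ℕ × Bool) × σ → Prop} {F : σ → Prop} (hs : s ∈ Q)
    (hP : ∀ a x b, a ∈ Q → P (a, x, b) → x ∈ X ∧ b ∈ Q) {w : List (ℕ × Bool)} :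
    w ∈ (automatonCode Q X s P F).toNFA.accepts ↔
      ∃ t, F t ∧ Walk (fun a x b => P (a, x, b)) s w t := by
  classical
  set c := automatonCode Q X s P F with hc
  have hstep : ∀ (i j : Fin c.1) (a : σ) (x : ℕ × Bool), (i : ℕ) = Encodable.encode a →
      (j ∈ c.toNFA.step i x ↔ ∃ b, (j : ℕ) = Encodable.encode b ∧ a ∈ Q ∧ x ∈ X ∧ b ∈ Q ∧
        P (a, x, b)) := by
    intro i j a x hi
    have h0 : j ∈ c.toNFA.step i x ↔ ((i : ℕ), x, (j : ℕ)) ∈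
      ((triples Q X).filter fun z => P z).map
        (fun z => (Encodable.encode z.1, z.2.1, Encodable.encode z.2.2)) := Iff.rfl
    rw [h0]
    simp only [List.mem_map, List.mem_filter, mem_triples, decide_eq_true_eq, Prod.mk.injEq]
    constructor
    · rintro ⟨⟨a', x', b⟩, ⟨⟨h1, h2, h3⟩, h4⟩, h5, rfl, h6⟩
      obtain rfl := Encodable.encode_injective (h5.trans hi)
      exact ⟨b, h6.symm, h1, h2, h3, h4⟩
    · rintro ⟨b, h6, h1, h2, h3, h4⟩
      exact ⟨(a, x, b), ⟨⟨h1, h2, h3⟩, h4⟩, hi.symm, rfl, h6.symm⟩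
  have key : ∀ (w : List (ℕ × Bool)) (i : Fin c.1) (a : σ), (i : ℕ) = Encodable.encode a →
      a ∈ Q → ((∃ j, j ∈ c.toNFA.accept ∧ Walk (fun a x b => b ∈ c.toNFA.step a x) i w j) ↔
        ∃ t, F t ∧ Walk (fun a x b => P (a, x, b)) a w t) := by
    intro w
    induction w with
    | nil =>
      intro i a hi ha
      have h0 : i ∈ c.toNFA.accept ↔ (i : ℕ) ∈ (Q.filter fun t => F t).map Encodable.encode :=
        Iff.rfl
      simp only [Walk, exists_eq_right', h0, List.mem_map, List.mem_filter, decide_eq_true_eq]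
      constructor
      · rintro ⟨b, ⟨-, h2⟩, h3⟩
        obtain rfl := Encodable.encode_injective (h3.trans hi)
        exact h2
      · exact fun h => ⟨a, ⟨ha, h⟩, hi.symm⟩
    | cons x w ih =>
      intro i a hi ha
      simp only [Walk]
      constructor
      · rintro ⟨j, hj, k, hk, h⟩
        obtain ⟨b, hb, -, -, hbQ, hab⟩ := (hstep i k a x hi).1 hk
        obtain ⟨t, ht, h'⟩ := (ih k b hb hbQ).1 ⟨j, hj, h⟩
        exact ⟨t, ht, b, hab, h'⟩
      · rintro ⟨t, ht, b, hab, h⟩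
        obtain ⟨hx, hbQ⟩ := hP _ _ _ ha hab
        let k : Fin c.1 := ⟨Encodable.encode b, encode_lt_automatonCode hbQ⟩
        obtain ⟨j, hj, h'⟩ := (ih k b rfl hbQ).2 ⟨t, ht, h⟩
        exact ⟨j, hj, k, (hstep i k a x hi).2 ⟨b, rfl, ha, hx, hbQ, hab⟩, h'⟩
  rw [mem_accepts_iff_walk, ← key w ⟨Encodable.encode s, encode_lt_automatonCode hs⟩ s rfl hs]
  have hstart : ∀ i : Fin c.1, i ∈ c.toNFA.start ↔ (i : ℕ) = Encodable.encode s := fun i => by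
    have h0 : i ∈ c.toNFA.start ↔ (i : ℕ) ∈ [Encodable.encode s] := Iff.rfl
    rw [h0, List.mem_singleton]
  constructor
  · rintro ⟨i, j, hi, hj, h⟩
    obtain rfl : i = ⟨Encodable.encode s, encode_lt_automatonCode hs⟩ := Fin.ext ((hstart i).1 hi)
    exact ⟨j, hj, h⟩
  · rintro ⟨j, hj, h⟩
    exact ⟨_, j, (hstart _).2 rfl, hj, h⟩

open Primrec in
theorem primrec_automatonCode {γ : Type*} {σ : Type} [Primcodable γ] [Primcodable σ]
    {Q : γ → List σ} {X : γ → List (ℕ × Bool)} {s : γ → σ} {P : γ → σ × (ℕ × Bool) × σ → Prop}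
    {F : γ → σ → Prop} (hQ : Primrec Q) (hX : Primrec X) (hs : Primrec s) (hP : PrimrecRel P)
    (hF : PrimrecRel F) : Primrec fun c => automatonCode (Q c) (X c) (s c) (P c) (F c) := by
  classical
  have henc : Primrec fun c => (Q c).map Encodable.encode :=
    list_map hQ (Primrec.encode.comp snd).to₂
  have htri : Primrec fun c => triples (Q c) (X c) := by
    refine list_flatMap hQ (list_flatMap (hX.comp fst) (list_map (hQ.comp (fst.comp fst)) ?_))
    exact (snd.comp (fst.comp fst)).pair ((snd.comp fst).pair snd)
  refine Primrec.pair ?_ (Primrec.pair ?_ (Primrec.pair ?_ ?_))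
  · exact succ.comp (list_foldr henc (const 0) (nat_add.comp (fst.comp snd) (snd.comp snd)).to₂)
  · exact list_cons.comp (Primrec.encode.comp hs) (const [])
  · refine list_map (primrec_filter htri hP) ?_
    exact (Primrec.encode.comp (fst.comp snd)).pair ((fst.comp (snd.comp snd)).pair
      (Primrec.encode.comp (snd.comp (snd.comp snd))))
  · exact list_map (primrec_filter hQ hF) (Primrec.encode.comp snd)

end Code

/-! ### Reduced words read with a jump -/

section Jump

variable {α P : Type*} (arc : P → α × Bool → P → Prop) (jump : P → P → Prop) (fin : P → Prop)

/-- Transitions between states that consist of a vertex, the last letter read, and a Boolean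
telling whether the jump has been performed. -/
def jumpStep (z : (P × List (α × Bool) × Bool) × (α × Bool) × (P × List (α × Bool) × Bool)) :
    Prop :=
  z.2.2.2.1 = [z.2.1] ∧ z.1.2.1 ≠ [letterInv z.2.1] ∧
    ((z.1.2.2 = z.2.2.2.2 ∧ arc z.1.1 z.2.1 z.2.2.1) ∨
      (z.1.2.2 = false ∧ z.2.2.2.2 = true ∧ ∃ q, jump z.1.1 q ∧ arc q z.2.1 z.2.2.1))

/-- Final states: the vertex is final, possibly after a jump. -/
def jumpFinal (s : P × List (α × Bool) × Bool) : Prop :=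
  (s.2.2 = true ∧ fin s.1) ∨ (s.2.2 = false ∧ ∃ q, jump s.1 q ∧ fin q)

variable {arc jump fin}

theorem isReduced_append_cons_iff {l : List (α × Bool)} (hl : l.length ≤ 1) {x : α × Bool}
    {w : List (α × Bool)} : FreeGroup.IsReduced (l ++ x :: w) ↔
      l ≠ [letterInv x] ∧ FreeGroup.IsReduced ([x] ++ w) := by
  rcases l with _ | ⟨y, _ | ⟨z, l⟩⟩
  · simp
  · rw [List.singleton_append, isReduced_cons_cons_iff]
    refine and_congr_left fun _ => not_congr ?_
    rw [List.cons.injEq, and_iff_left rfl]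
    constructor
    · rintro rfl; simp
    · rintro rfl; simp
  · simp at hl

theorem isReduced_of_length_le_one {l : List (α × Bool)} (hl : l.length ≤ 1) :
    FreeGroup.IsReduced l := by
  rcases l with _ | ⟨y, _ | ⟨z, l⟩⟩
  · exact .nil
  · exact .singleton
  · simp at hl

theorem exists_walk_jumpStep_true {w l : List (α × Bool)} {p : P} (hl : l.length ≤ 1) :
    (∃ t, jumpFinal jump fin t ∧ Walk (fun a x b => jumpStep arc jump (a, x, b)) (p, l, true) w t) ↔
      FreeGroup.IsReduced (l ++ w) ∧ ∃ q, fin q ∧ Walk arc p w q := by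
  induction w generalizing p l with
  | nil => simp [Walk, jumpFinal, isReduced_of_length_le_one hl]
  | cons x w ih =>
    rw [isReduced_append_cons_iff hl]
    constructor
    · rintro ⟨t, ht, ⟨p', l', b⟩, ⟨h1, h2, ⟨h3, h4⟩ | ⟨h3, -⟩⟩, h⟩
      · obtain rfl : l' = [x] := h1
        obtain rfl : true = b := h3
        obtain ⟨h5, q, hq, h6⟩ := (ih (l := [x]) le_rfl).1 ⟨t, ht, h⟩
        exact ⟨⟨h2, h5⟩, q, hq, p', h4, h6⟩
      · cases h3
    · rintro ⟨⟨h2, h5⟩, q, hq, p', h4, h6⟩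
      obtain ⟨t, ht, h⟩ := (ih (l := [x]) le_rfl).2 ⟨h5, q, hq, h6⟩
      exact ⟨t, ht, (p', [x], true), ⟨rfl, h2, .inl ⟨rfl, h4⟩⟩, h⟩

/-- The jump is merged with the letter that follows it, or with acceptance if none follows, so no
empty transitions are needed. The remembered letter `l` enforces reducedness, also across the jump.
-/
theorem exists_walk_jumpStep_false {w l : List (α × Bool)} {p : P} (hl : l.length ≤ 1) :
    (∃ t, jumpFinal jump fin t ∧
        Walk (fun a x b => jumpStep arc jump (a, x, b)) (p, l, false) w t) ↔
      FreeGroup.IsReduced (l ++ w) ∧ ∃ u v r s q, w = u ++ v ∧ Walk arc p u r ∧ jump r s ∧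
        Walk arc s v q ∧ fin q := by
  induction w generalizing p l with
  | nil =>
    simp only [Walk, exists_eq_right', List.append_nil, isReduced_of_length_le_one hl, true_and]
    constructor
    · rintro (⟨h, -⟩ | ⟨-, q, h1, h2⟩)
      · cases h
      · exact ⟨[], [], p, q, q, rfl, rfl, h1, rfl, h2⟩
    · rintro ⟨u, v, r, s, q, he, h1, h2, h3, h4⟩
      obtain ⟨rfl, rfl⟩ := List.append_eq_nil_iff.1 he.symm
      cases h1
      cases h3
      exact .inr ⟨rfl, s, h2, h4⟩
  | cons x w ih =>
    rw [isReduced_append_cons_iff hl]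
    constructor
    · rintro ⟨t, ht, ⟨p', l', b⟩, ⟨h1, h2, ⟨h3, h4⟩ | ⟨-, h3, s, hs, h4⟩⟩, h⟩
      · obtain rfl : l' = [x] := h1
        obtain rfl : false = b := h3
        obtain ⟨h5, u, v, r, s, q, rfl, h6, h7⟩ := (ih (l := [x]) le_rfl).1 ⟨t, ht, h⟩
        exact ⟨⟨h2, h5⟩, x :: u, v, r, s, q, rfl, ⟨p', h4, h6⟩, h7⟩
      · obtain rfl : l' = [x] := h1
        obtain rfl : b = true := h3
        obtain ⟨h5, q, hq, h6⟩ := (exists_walk_jumpStep_true (l := [x]) le_rfl).1 ⟨t, ht, h⟩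
        exact ⟨⟨h2, h5⟩, [], x :: w, p, s, q, rfl, rfl, hs, ⟨p', h4, h6⟩, hq⟩
    · rintro ⟨⟨h2, h5⟩, u, v, r, s, q, he, h6, h7, h8, h9⟩
      cases u with
      | nil =>
        obtain rfl : x :: w = v := he
        cases h6
        obtain ⟨p', h4, h8⟩ := h8
        obtain ⟨t, ht, h⟩ := (exists_walk_jumpStep_true (arc := arc) (jump := jump) (fin := fin)
          (l := [x]) le_rfl).2 ⟨h5, q, h9, h8⟩
        exact ⟨t, ht, (p', [x], true), ⟨rfl, h2, .inr ⟨rfl, rfl, s, h7, h4⟩⟩, h⟩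
      | cons y u =>
        obtain ⟨rfl, rfl⟩ := List.cons.inj he
        obtain ⟨p', h4, h6⟩ := h6
        obtain ⟨t, ht, h⟩ := (ih (l := [x]) le_rfl).2 ⟨h5, u, v, r, s, q, rfl, h6, h7, h8, h9⟩
        exact ⟨t, ht, (p', [x], false), ⟨rfl, h2, .inl ⟨rfl, h4⟩⟩, h⟩

end Jump

/-! ### The automaton of the join-cocycles -/

/-- The list of the words that name the vertices of a ball in a Schreier automaton. -/
def vertexWords (n : ℕ) (S : List NatWord) : List NatWord := ball n (S.flatten.length + 1)

/-- The arcs between the cosets named by two words. -/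
def schreierArc (n : ℕ) (S : List NatWord) (p : NatWord) (x : ℕ × Bool) (q : NatWord) : Prop :=
  p ∈ vertexWords n S ∧ x ∈ letters n ∧ q ∈ vertexWords n S ∧
    MemGenerated n S (p ++ [x] ++ FreeGroup.invRev q)

/-- The pairs of words such that identifying the cosets named by them yields the whole group. -/
def joinJump (n : ℕ) (S : List NatWord) (p q : NatWord) : Prop :=
  p ∈ vertexWords n S ∧ q ∈ vertexWords n S ∧
    ∀ x ∈ letters n, MemGenerated n ((p ++ FreeGroup.invRev q) :: S) [x]

/-- The words that name the trivial coset. -/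
def schreierFinal (n : ℕ) (S : List NatWord) (p : NatWord) : Prop :=
  p ∈ vertexWords n S ∧ MemGenerated n S p

/-- The states of the automaton of the join-cocycles. -/
def cocycleStates (n : ℕ) (S : List NatWord) : List (NatWord × NatWord × Bool) :=
  (vertexWords n S).flatMap fun p => (ball n 1).flatMap fun l => [(p, l, true), (p, l, false)]

/-- The automaton of the join-cocycles of the subgroup generated by a list of words. -/
noncomputable def cocycleCode (c : ℕ × List NatWord) : AutomatonCode :=
  automatonCode (cocycleStates c.1 c.2) (letters c.1) ([], [], false)
    (jumpStep (schreierArc c.1 c.2) (joinJump c.1 c.2))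
    (jumpFinal (joinJump c.1 c.2) (schreierFinal c.1 c.2))

section Correct

theorem mem_cocycleStates {n : ℕ} {S : List NatWord} {s : NatWord × NatWord × Bool} :
    s ∈ cocycleStates n S ↔ s.1 ∈ vertexWords n S ∧ s.2.1 ∈ ball n 1 := by
  obtain ⟨p, l, b⟩ := s
  cases b <;> simp [cocycleStates]

theorem mem_accepts_cocycleCode {n : ℕ} {S : List NatWord} {w : NatWord} :
    w ∈ (cocycleCode (n, S)).toNFA.accepts ↔
      FreeGroup.IsReduced w ∧ ∃ u v r s q, w = u ++ v ∧ Walk (schreierArc n S) [] u r ∧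
        joinJump n S r s ∧ Walk (schreierArc n S) s v q ∧ schreierFinal n S q := by
  rw [cocycleCode, mem_accepts_automatonCode]
  · exact exists_walk_jumpStep_false (l := []) (by simp)
  · exact mem_cocycleStates.2 ⟨mem_ball.2 (by simp), mem_ball.2 (by simp)⟩
  · rintro a x ⟨b, l, t⟩ - ⟨h1, -, h⟩
    have hx : x ∈ letters n ∧ b ∈ vertexWords n S := by
      rcases h with ⟨-, h⟩ | ⟨-, -, q, -, h⟩
      · exact ⟨h.2.1, h.2.2.1⟩
      · exact ⟨h.2.1, h.2.2.1⟩
    refine ⟨hx.1, mem_cocycleStates.2 ⟨hx.2, ?_⟩⟩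
    obtain rfl : l = [x] := h1
    exact mem_ball.2 ⟨le_rfl, by simpa using mem_letters.1 hx.1⟩

/-- Since `a * b = (a * r⁻¹) * (r * s⁻¹) * (s * b * q⁻¹ * q)` with outer factors in `H`, the join
depends only on the two ends of the jump. -/
theorem sup_zpowers_eq {G : Type*} [Group G] (H : Subgroup G) {a b r s q : G}
    (ha : a * r⁻¹ ∈ H) (hb : s * b * q⁻¹ ∈ H) (hq : q ∈ H) :
    H ⊔ Subgroup.zpowers (a * b) = H ⊔ Subgroup.zpowers (r * s⁻¹) := by
  have key : ∀ x y : G, x ∈ H → y ∈ H → ∀ g, H ⊔ Subgroup.zpowers (x * g * y) ≤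
      H ⊔ Subgroup.zpowers g := by
    intro x y hx hy g
    have hle : H ≤ H ⊔ Subgroup.zpowers g := le_sup_left
    refine sup_le hle ((Subgroup.zpowers_le).2 (mul_mem (mul_mem (hle hx) ?_) (hle hy)))
    exact (le_sup_right : _ ≤ H ⊔ Subgroup.zpowers g) (Subgroup.mem_zpowers g)
  apply le_antisymm
  · have := key _ _ ha (mul_mem hb hq) (r * s⁻¹)
    rwa [show a * r⁻¹ * (r * s⁻¹) * (s * b * q⁻¹ * q) = a * b by group] at this
  · have := key _ _ (inv_mem ha) (inv_mem (mul_mem hb hq)) (a * b)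
    rwa [show (a * r⁻¹)⁻¹ * (a * b) * (s * b * q⁻¹ * q)⁻¹ = r * s⁻¹ by group] at this

variable {n : ℕ} {S : List (List (Fin n × Bool))}

theorem encodeWord_cons (x : Fin n × Bool) (w : List (Fin n × Bool)) :
    encodeWord (x :: w) = ((x.1 : ℕ), x.2) :: encodeWord w := rfl

theorem isReduced_encodeWord {w : List (Fin n × Bool)} :
    FreeGroup.IsReduced (encodeWord w) ↔ FreeGroup.IsReduced w := by
  rw [FreeGroup.isReduced_iff_reduce_eq, FreeGroup.isReduced_iff_reduce_eq]
  have : FreeGroup.reduce (encodeWord w) = encodeWord (FreeGroup.reduce w) := by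
    induction w with
    | nil => rfl
    | cons x w ih =>
      rw [encodeWord_cons, FreeGroup.reduce.cons, FreeGroup.reduce.cons, ih]
      rcases FreeGroup.reduce w with _ | ⟨y, v⟩
      · rfl
      · simp only [encodeWord_cons, Fin.val_inj]
        split_ifs <;> rfl
  rw [this, encodeWord_injective.eq_iff]

/-- The bound on the length of the words that name vertices. -/
def vertexBound (S : List (List (Fin n × Bool))) : ℕ := (S.map encodeWord).flatten.length + 1

theorem length_le_vertexBound {s : List (Fin n × Bool)} (hs : s ∈ S) :
    s.length ≤ vertexBound S := by
  rw [vertexBound, List.length_flatten, List.map_map]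
  exact (List.le_sum_of_mem (List.mem_map.2 ⟨s, hs, length_encodeWord s⟩)).trans (Nat.le_succ _)

theorem encodeWord_mem_vertexWords {p : List (Fin n × Bool)} :
    encodeWord p ∈ vertexWords n (S.map encodeWord) ↔ p.length ≤ vertexBound S :=
  encodeWord_mem_ball

theorem schreierArc_encodeWord {p q : List (Fin n × Bool)} {x : Fin n × Bool} :
    schreierArc n (S.map encodeWord) (encodeWord p) ((x.1 : ℕ), x.2) (encodeWord q) ↔
      p.length ≤ vertexBound S ∧ q.length ≤ vertexBound S ∧
        FreeGroup.mk p * FreeGroup.mk [x] * (FreeGroup.mk q)⁻¹ ∈ generated S := by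
  have h : encodeWord p ++ [((x.1 : ℕ), x.2)] ++ FreeGroup.invRev (encodeWord q) =
      encodeWord (p ++ [x] ++ FreeGroup.invRev q) := by
    rw [encodeWord_append, encodeWord_append, encodeWord_invRev]
    rfl
  rw [schreierArc, h, memGenerated_iff, encodeWord_mem_vertexWords, encodeWord_mem_vertexWords,
    mem_letters, mk_append_invRev, FreeGroup.mul_mk]
  exact and_congr_right fun _ => and_iff_right x.1.2

theorem joinJump_encodeWord {p q : List (Fin n × Bool)} :
    joinJump n (S.map encodeWord) (encodeWord p) (encodeWord q) ↔
      p.length ≤ vertexBound S ∧ q.length ≤ vertexBound S ∧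
        generated S ⊔ Subgroup.zpowers (FreeGroup.mk p * (FreeGroup.mk q)⁻¹) = ⊤ := by
  have h : (encodeWord p ++ FreeGroup.invRev (encodeWord q)) :: S.map encodeWord =
      ((p ++ FreeGroup.invRev q) :: S).map encodeWord := by
    rw [List.map_cons, encodeWord_append, encodeWord_invRev]
  rw [joinJump, h, encodeWord_mem_vertexWords, encodeWord_mem_vertexWords, ← mk_append_invRev,
    ← generated_cons]
  refine and_congr_right fun _ => and_congr_right fun _ => ?_
  constructor
  · intro h
    refine eq_top_of_of_mem _ fun a => ?_
    exact memGenerated_iff.1 (h ((a : ℕ), true) (mem_letters.2 a.2))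
  · rintro h ⟨i, b⟩ hx
    have : ([(i, b)] : NatWord) = encodeWord [((⟨i, mem_letters.1 hx⟩ : Fin n), b)] := rfl
    rw [this, memGenerated_iff, h]
    trivial

theorem schreierFinal_encodeWord {p : List (Fin n × Bool)} :
    schreierFinal n (S.map encodeWord) (encodeWord p) ↔
      p.length ≤ vertexBound S ∧ FreeGroup.mk p ∈ generated S := by
  rw [schreierFinal, memGenerated_iff, encodeWord_mem_vertexWords]

theorem exists_of_walk_schreierArc {p : List (Fin n × Bool)} {w q : NatWord}
    (h : Walk (schreierArc n (S.map encodeWord)) (encodeWord p) w q) :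
    ∃ v t : List (Fin n × Bool), encodeWord v = w ∧ encodeWord t = q ∧
      FreeGroup.mk p * FreeGroup.mk v * (FreeGroup.mk t)⁻¹ ∈ generated S := by
  induction w generalizing p with
  | nil =>
    cases h
    exact ⟨[], p, rfl, rfl, by rw [mk_nil, mul_one, mul_inv_cancel]; exact one_mem _⟩
  | cons x w ih =>
    obtain ⟨r, h1, h2⟩ := h
    obtain ⟨i, b⟩ := x
    obtain ⟨r, rfl⟩ := exists_of_mem_ball h1.2.2.1
    obtain ⟨v, t, rfl, rfl, h3⟩ := ih h2
    obtain ⟨-, -, h4⟩ := schreierArc_encodeWord (x := (⟨i, mem_letters.1 h1.2.1⟩, b)).1 h1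
    refine ⟨(⟨i, mem_letters.1 h1.2.1⟩, b) :: v, t, rfl, rfl, ?_⟩
    rw [mk_cons]
    convert mul_mem h4 h3 using 1
    group

theorem mk_mul_of_walk_schreierArc {p v t : List (Fin n × Bool)}
    (h : Walk (schreierArc n (S.map encodeWord)) (encodeWord p) (encodeWord v) (encodeWord t)) :
    FreeGroup.mk p * FreeGroup.mk v * (FreeGroup.mk t)⁻¹ ∈ generated S := by
  obtain ⟨v', t', h1, h2, h3⟩ := exists_of_walk_schreierArc h
  rwa [encodeWord_injective h1, encodeWord_injective h2] at h3

/-- The cosets named by short words. -/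
abbrev BallCoset (S : List (List (Fin n × Bool))) : Type :=
  {C : Quotient (QuotientGroup.rightRel (generated S)) //
    ∃ p : List (Fin n × Bool), p.length ≤ vertexBound S ∧ C = Quotient.mk _ (FreeGroup.mk p)}

/-- The restriction of the Schreier automaton to the cosets named by short words. -/
def ballStep (S : List (List (Fin n × Bool))) (C : BallCoset S) (x : Fin n × Bool)
    (D : BallCoset S) : Prop :=
  cosetMul (generated S) (FreeGroup.mk [x]) C.1 = D.1

theorem ballStep_isInverse (S : List (List (Fin n × Bool))) : IsInverse (ballStep S) where
  symm h := by
    unfold ballStep at h ⊢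
    rw [mk_letterInv, ← h, cosetMul_inv]
  det h h' := Subtype.ext (Eq.trans (Eq.symm h) h')

/-- The coset named by a short word. -/
def ballCoset (p : List (Fin n × Bool)) (hp : p.length ≤ vertexBound S) : BallCoset S :=
  ⟨Quotient.mk _ (FreeGroup.mk p), p, hp, rfl⟩

theorem ballCoset_eq_iff {p q : List (Fin n × Bool)} {hp : p.length ≤ vertexBound S}
    {hq : q.length ≤ vertexBound S} : ballCoset p hp = ballCoset q hq ↔
      FreeGroup.mk p * (FreeGroup.mk q)⁻¹ ∈ generated S := by
  rw [Subtype.ext_iff]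
  exact coset_eq_iff _

theorem ballStep_ballCoset {p q : List (Fin n × Bool)} {x : Fin n × Bool}
    {hp : p.length ≤ vertexBound S} {hq : q.length ≤ vertexBound S} :
    ballStep S (ballCoset p hp) x (ballCoset q hq) ↔
      FreeGroup.mk p * FreeGroup.mk [x] * (FreeGroup.mk q)⁻¹ ∈ generated S :=
  coset_eq_iff _

theorem walk_ballStep_of_length_le (w u : List (Fin n × Bool)) (hu : u.length ≤ vertexBound S)
    (h : (u ++ w).length ≤ vertexBound S) :
    Walk (ballStep S) (ballCoset u hu) w (ballCoset (u ++ w) h) := by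
  induction w generalizing u with
  | nil => simp [Walk]
  | cons x w ih =>
    have hx : (u ++ [x]).length ≤ vertexBound S := by
      simp only [List.length_append, List.length_cons, List.length_nil] at h ⊢
      omega
    refine ⟨ballCoset (u ++ [x]) hx, ballStep_ballCoset.2 ?_, ?_⟩
    · rw [FreeGroup.mul_mk, mul_inv_cancel]
      exact one_mem _
    · simpa using ih (u ++ [x]) hx (by simpa using h)

/-- Arcs between words depend only on the cosets they name, so a walk of cosets lifts with any
choice of short representatives. -/
theorem exists_walk_schreierArc {p w : List (Fin n × Bool)} {hp : p.length ≤ vertexBound S}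
    {D : BallCoset S} (h : Walk (ballStep S) (ballCoset p hp) w D) :
    ∃ (q : List (Fin n × Bool)) (hq : q.length ≤ vertexBound S), D = ballCoset q hq ∧
      Walk (schreierArc n (S.map encodeWord)) (encodeWord p) (encodeWord w) (encodeWord q) := by
  induction w generalizing p with
  | nil => exact ⟨p, hp, Eq.symm h, rfl⟩
  | cons x w ih =>
    obtain ⟨⟨C, r, hr, rfl⟩, h1, h2⟩ := h
    obtain ⟨q, hq, hD, h3⟩ := ih (hp := hr) h2
    exact ⟨q, hq, hD, encodeWord r,
      schreierArc_encodeWord.2 ⟨hp, hr, (ballStep_ballCoset (hp := hp) (hq := hr)).1 h1⟩, h3⟩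

theorem generated_le_subgroup_ballStep (S : List (List (Fin n × Bool))) :
    generated S ≤ (ballStep_isInverse S).subgroup (ballCoset [] (by simp)) := by
  rw [generated, Subgroup.closure_le]
  rintro _ ⟨s, hs, rfl⟩
  refine ⟨s, ?_, rfl⟩
  have := walk_ballStep_of_length_le s [] (by simp) (length_le_vertexBound hs)
  have he : ballCoset ([] ++ s) (length_le_vertexBound hs) = ballCoset [] (by simp) :=
    ballCoset_eq_iff.2 (by rw [mk_nil, inv_one, mul_one]; exact mk_mem_generated hs)
  rwa [he] at this

theorem exists_walks_of_mem_joinCocycles {w : List (Fin n × Bool)} (hw : FreeGroup.IsReduced w)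
    (h : generated S ⊔ Subgroup.zpowers (FreeGroup.mk w) = ⊤) :
    ∃ u v r s q : List (Fin n × Bool), w = u ++ v ∧ r.length ≤ vertexBound S ∧
      s.length ≤ vertexBound S ∧ q.length ≤ vertexBound S ∧ FreeGroup.mk q ∈ generated S ∧
      Walk (schreierArc n (S.map encodeWord)) (encodeWord (n := n) []) (encodeWord u) (encodeWord r) ∧
      Walk (schreierArc n (S.map encodeWord)) (encodeWord s) (encodeWord v) (encodeWord q) := by
  -- For the whole group no letter leaves the trivial coset, but then every word is read by loops at
  -- the empty word.
  by_cases htop : generated S = ⊤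
  · have hread : ∀ w : List (Fin n × Bool), Walk (schreierArc n (S.map encodeWord))
        (encodeWord (n := n) []) (encodeWord w) (encodeWord (n := n) []) := by
      intro w
      induction w with
      | nil => rfl
      | cons x w ih =>
        refine ⟨encodeWord (n := n) [], schreierArc_encodeWord.2 ⟨by simp, by simp, ?_⟩, ih⟩
        rw [htop]
        trivial
    exact ⟨w, [], [], [], [], by simp, by simp, by simp, by simp, one_mem _, hread w, rfl⟩
  · obtain ⟨a, ha⟩ : ∃ a, FreeGroup.of a ∉ generated S := by
      by_contra! hall
      exact htop (eq_top_of_of_mem _ hall)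
    -- The extra `1` in `vertexBound` is for this: one-letter words must name vertices even when `S`
    -- is empty.
    have hlen : [(a, true)].length ≤ vertexBound S := by simp [vertexBound]
    obtain ⟨u, v, C, D, rfl, h1, h2⟩ := (ballStep_isInverse S).exists_split
      (b := ballCoset [] (by simp)) (c := ballCoset [(a, true)] hlen) (x := (a, true))
      (ballStep_ballCoset.2 (by rw [mk_nil, one_mul, mul_inv_cancel]; exact one_mem _))
      (fun he => ha (by
        have := ballCoset_eq_iff.1 he
        rwa [mk_nil, inv_one, mul_one] at this))
      (generated_le_subgroup_ballStep S) hw (h ▸ Subgroup.mem_top _)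
    obtain ⟨r, hr, -, h1⟩ := exists_walk_schreierArc h1
    obtain ⟨D, s, hs, rfl⟩ := D
    obtain ⟨q, hq, he, h2⟩ := exists_walk_schreierArc (hp := hs) h2
    refine ⟨u, v, r, s, q, rfl, hr, hs, hq, ?_, h1, h2⟩
    simpa [mk_nil] using ballCoset_eq_iff.1 he.symm

theorem accepts_cocycleCode (S : List (List (Fin n × Bool))) :
    (cocycleCode (n, S.map encodeWord)).toNFA.accepts =
      {w | ∃ u ∈ reducedForms (joinCocycles (generated S)), encodeWord u = w} := by
  refine Language.ext fun w => ?_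
  rw [mem_accepts_cocycleCode]
  constructor
  · rintro ⟨hw, u, v, r, s, q, rfl, h1, h2, h3, h4⟩
    obtain ⟨u, r, rfl, rfl, hu⟩ := exists_of_walk_schreierArc (p := []) h1
    obtain ⟨s, rfl⟩ := exists_of_mem_ball h2.2.1
    obtain ⟨v, q, rfl, rfl, hv⟩ := exists_of_walk_schreierArc h3
    rw [mk_nil, one_mul] at hu
    refine ⟨u ++ v, ⟨isReduced_encodeWord.1 (by rwa [encodeWord_append]), ?_⟩,
      encodeWord_append _ _⟩
    change _ ⊔ _ = _
    rw [← FreeGroup.mul_mk, sup_zpowers_eq (generated S) hu hv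
      (schreierFinal_encodeWord.1 h4).2]
    exact (joinJump_encodeWord.1 h2).2.2
  · rintro ⟨w, ⟨hw, h⟩, rfl⟩
    obtain ⟨u, v, r, s, q, rfl, hr, hs, hq, hqH, h1, h2⟩ := exists_walks_of_mem_joinCocycles hw h
    refine ⟨isReduced_encodeWord.2 hw, encodeWord u, encodeWord v, encodeWord r, encodeWord s,
      encodeWord q, encodeWord_append _ _, h1, joinJump_encodeWord.2 ⟨hr, hs, ?_⟩, h2,
      schreierFinal_encodeWord.2 ⟨hq, hqH⟩⟩
    have hu := mk_mul_of_walk_schreierArc h1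
    rw [mk_nil, one_mul] at hu
    rw [← sup_zpowers_eq (generated S) hu
      (mk_mul_of_walk_schreierArc h2) hqH, FreeGroup.mul_mk]
    exact h

end Correct

/-! ### Effectiveness -/

section Effective

open Primrec

variable {γ : Type*} [Primcodable γ] {f : γ → ℕ × List NatWord}

theorem primrec_vertexWords (hf : Primrec f) :
    Primrec fun c => vertexWords (f c).1 (f c).2 :=
  primrec_ball.comp (fst.comp hf)
    (succ.comp (list_length.comp (list_flatten.comp (snd.comp hf))))

theorem primrecPred_schreierArc {p q : γ → NatWord} {x : γ → ℕ × Bool} (hf : Primrec f)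
    (hp : Primrec p) (hx : Primrec x) (hq : Primrec q) :
    PrimrecPred fun c => schreierArc (f c).1 (f c).2 (p c) (x c) (q c) :=
  .and (primrecPred_mem (primrec_vertexWords hf) hp)
    (.and (primrecPred_mem (primrec_letters.comp (fst.comp hf)) hx)
      (.and (primrecPred_mem (primrec_vertexWords hf) hq)
        (primrecPred_memGenerated (fst.comp hf) (snd.comp hf)
          (list_append.comp (list_append.comp hp (list_cons.comp hx (const [])))
            (primrec_invRev.comp hq)))))

theorem primrecPred_joinJump {p q : γ → NatWord} (hf : Primrec f) (hp : Primrec p)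
    (hq : Primrec q) : PrimrecPred fun c => joinJump (f c).1 (f c).2 (p c) (q c) := by
  refine .and (primrecPred_mem (primrec_vertexWords hf) hp)
    (.and (primrecPred_mem (primrec_vertexWords hf) hq) ?_)
  refine primrecPred_forall_mem (primrec_letters.comp (fst.comp hf)) ?_
  exact primrecPred_memGenerated (fst.comp (hf.comp fst))
    (list_cons.comp (list_append.comp (hp.comp fst) (primrec_invRev.comp (hq.comp fst)))
      (snd.comp (hf.comp fst))) (list_cons.comp snd (const []))

theorem primrecPred_schreierFinal {p : γ → NatWord} (hf : Primrec f) (hp : Primrec p) :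
    PrimrecPred fun c => schreierFinal (f c).1 (f c).2 (p c) :=
  .and (primrecPred_mem (primrec_vertexWords hf) hp)
    (primrecPred_memGenerated (fst.comp hf) (snd.comp hf) hp)

theorem primrec_cocycleStates :
    Primrec fun c : ℕ × List NatWord => cocycleStates c.1 c.2 := by
  refine list_flatMap (primrec_vertexWords .id)
    (list_flatMap (primrec_ball.comp (fst.comp fst) (const 1)) ?_)
  have h : ∀ b : Bool, Primrec fun z : ((ℕ × List NatWord) × NatWord) × NatWord =>
      (z.1.2, z.2, b) := fun b => (snd.comp fst).pair (snd.pair (const b))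
  exact list_cons.comp (h true) (list_cons.comp (h false) (const []))

theorem primrecRel_jumpStep : PrimrecRel fun (c : ℕ × List NatWord)
    (z : (NatWord × NatWord × Bool) × (ℕ × Bool) × (NatWord × NatWord × Bool)) =>
      jumpStep (schreierArc c.1 c.2) (joinJump c.1 c.2) z := by
  have ha : Primrec fun z : (ℕ × List NatWord) ×
      ((NatWord × NatWord × Bool) × (ℕ × Bool) × (NatWord × NatWord × Bool)) => z.2.1 :=
    fst.comp snd
  have hx : Primrec fun z : (ℕ × List NatWord) ×
      ((NatWord × NatWord × Bool) × (ℕ × Bool) × (NatWord × NatWord × Bool)) => z.2.2.1 :=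
    fst.comp (snd.comp snd)
  have hb : Primrec fun z : (ℕ × List NatWord) ×
      ((NatWord × NatWord × Bool) × (ℕ × Bool) × (NatWord × NatWord × Bool)) => z.2.2.2 :=
    snd.comp (snd.comp snd)
  refine .and (Primrec.eq.comp (fst.comp (snd.comp hb)) (list_cons.comp hx (const [])))
    (.and (.not (Primrec.eq.comp (fst.comp (snd.comp ha))
      (list_cons.comp (primrec_letterInv.comp hx) (const [])))) (.or ?_ ?_))
  · exact .and (Primrec.eq.comp (snd.comp (snd.comp ha)) (snd.comp (snd.comp hb)))
      (primrecPred_schreierArc fst (fst.comp ha) hx (fst.comp hb))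
  · refine .and (Primrec.eq.comp (snd.comp (snd.comp ha)) (const false))
      (.and (Primrec.eq.comp (snd.comp (snd.comp hb)) (const true)) ?_)
    -- `joinJump` forces its target to be a vertex word, so the existential is a search in a finite
    -- list.
    refine (primrecPred_exists_mem (primrec_vertexWords fst) (R := fun z q =>
      joinJump z.1.1 z.1.2 z.2.1.1 q ∧ schreierArc z.1.1 z.1.2 q z.2.2.1 z.2.2.2.1) ?_).of_eq
      fun z => ?_
    · exact .and (primrecPred_joinJump (fst.comp fst) (fst.comp (ha.comp fst)) snd)
        (primrecPred_schreierArc (fst.comp fst) snd (hx.comp fst) (fst.comp (hb.comp fst)))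
    · exact exists_congr fun q => and_iff_right_of_imp fun h => h.1.2.1

theorem primrecRel_jumpFinal : PrimrecRel fun (c : ℕ × List NatWord)
    (s : NatWord × NatWord × Bool) =>
      jumpFinal (joinJump c.1 c.2) (schreierFinal c.1 c.2) s := by
  have hb : Primrec fun z : (ℕ × List NatWord) × (NatWord × NatWord × Bool) => z.2.2.2 :=
    snd.comp (snd.comp snd)
  refine .or (.and (Primrec.eq.comp hb (const true))
    (primrecPred_schreierFinal fst (fst.comp snd)))
    (.and (Primrec.eq.comp hb (const false)) ?_)
  refine (primrecPred_exists_mem (primrec_vertexWords fst) (R := fun z q =>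
    joinJump z.1.1 z.1.2 z.2.1 q ∧ schreierFinal z.1.1 z.1.2 q) ?_).of_eq fun z => ?_
  · exact .and (primrecPred_joinJump (fst.comp fst) (fst.comp (snd.comp fst)) snd)
      (primrecPred_schreierFinal (fst.comp fst) snd)
  · exact exists_congr fun q => and_iff_right_of_imp fun h => h.1.2.1

theorem primrec_cocycleCode : Primrec cocycleCode :=
  primrec_automatonCode primrec_cocycleStates (primrec_letters.comp fst) (const _)
    primrecRel_jumpStep primrecRel_jumpFinal

end Effective

/-! ### Rationality -/

/-- The automaton output by the algorithm, with its labels pulled back along the encoding of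
letters, has finitely many states over a finite alphabet, so Kleene's theorem applies. -/
theorem isRationalLanguage_reducedForms_joinCocycles {n : ℕ} (H : Subgroup (FreeGroup (Fin n)))
    (hH : H.FG) : IsRationalLanguage (reducedForms (joinCocycles H)) := by
  classical
  obtain ⟨s, rfl⟩ := hH
  have hs : Subgroup.closure (s : Set (FreeGroup (Fin n))) =
      generated (s.toList.map FreeGroup.toWord) := by
    rw [generated]
    congr 1
    ext g
    simp [FreeGroup.mk_toWord]
  rw [hs]
  generalize s.toList.map FreeGroup.toWord = S
  let M := (cocycleCode (n, S.map encodeWord)).toNFA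
  have h := isRationalLanguage_walks
    (fun a (x : Fin n × Bool) b => b ∈ M.step a ((x.1 : ℕ), x.2)) (· ∈ M.start) (· ∈ M.accept)
  refine (congrArg IsRationalLanguage (Language.ext fun w => ?_)).mpr h
  have h1 : w ∈ reducedForms (joinCocycles (generated S)) ↔ encodeWord w ∈ M.accepts := by
    rw [accepts_cocycleCode]
    constructor
    · exact fun hw => ⟨w, hw, rfl⟩
    · rintro ⟨u, hu, he⟩
      rwa [← encodeWord_injective he]
  rw [h1, mem_accepts_iff_walk]
  simp only [encodeWord, walk_map]
  rfl

theorem isRationalSubset_of_reducedForms {α : Type u} {T : Set (FreeGroup α)}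
    (h : IsRationalLanguage (reducedForms T)) : IsRationalSubset T := by
  classical
  refine ⟨_, h, Set.ext fun g => ⟨fun hg => ?_, ?_⟩⟩
  · exact ⟨g.toWord, ⟨FreeGroup.isReduced_toWord, by rwa [FreeGroup.mk_toWord]⟩,
      FreeGroup.mk_toWord⟩
  · rintro ⟨w, hw, rfl⟩
    exact hw.2

end JoinCocycle

/-! ### Assembly of the theorem -/

theorem mainTheorem7 :
    (∀ (n : ℕ) (H : Subgroup (FreeGroup (Fin n))), H.FG →
      -- rationality, of the set of cocycles and of the language of their reduced forms
      JoinCocycle.IsRationalSubset (JoinCocycle.joinCocycles H) ∧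
      JoinCocycle.IsRationalLanguage
        (JoinCocycle.reducedForms (JoinCocycle.joinCocycles H)) ∧
      -- explicit description when the Stallings automaton has at least two vertices
      (Nontrivial (JoinCocycle.stallings H).V →
        JoinCocycle.reducedForms (JoinCocycle.joinCocycles H) =
          (⨆ (p : (JoinCocycle.stallings H).V) (q : (JoinCocycle.stallings H).V)
            (_ : ((JoinCocycle.stallings H).identify p q).reduction.IsBouquet Set.univ),
              (JoinCocycle.stallings H).lang (JoinCocycle.stallings H).base p *
                (JoinCocycle.stallings H).lang q (JoinCocycle.stallings H).base) ⊓
            JoinCocycle.reducedWords (Fin n)) ∧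
      -- explicit description when the Stallings automaton has a single vertex
      (Subsingleton (JoinCocycle.stallings H).V →
        ∃ B : Set (Fin n), (JoinCocycle.stallings H).IsBouquet B ∧
          (B = Set.univ → JoinCocycle.joinCocycles H = Set.univ) ∧
          (∀ a : Fin n, B = {a}ᶜ →
            JoinCocycle.joinCocycles H =
              {g | ∃ u ∈ Subgroup.closure (FreeGroup.of '' B),
                ∃ v ∈ Subgroup.closure (FreeGroup.of '' B),
                  g = u * FreeGroup.of a * v ∨ g = u * (FreeGroup.of a)⁻¹ * v}) ∧
          (B.ncard + 1 < n → JoinCocycle.joinCocycles H = ∅))) ∧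
    -- effectiveness: one algorithm, for all ranks and all finite generating lists
    (∃ f : ℕ × List (List (ℕ × Bool)) → JoinCocycle.AutomatonCode, Computable f ∧
      ∀ (n : ℕ) (S : List (List (Fin n × Bool))),
        (JoinCocycle.AutomatonCode.toNFA (f (n, S.map JoinCocycle.encodeWord))).accepts =
          {w | ∃ u ∈ JoinCocycle.reducedForms (JoinCocycle.joinCocycles
              (Subgroup.closure {g : FreeGroup (Fin n) | ∃ s ∈ S, FreeGroup.mk s = g})),
            JoinCocycle.encodeWord u = w}) := by

  refine ⟨fun n H hH => ?_, JoinCocycle.cocycleCode, JoinCocycle.primrec_cocycleCode.to_comp,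
    fun n S => JoinCocycle.accepts_cocycleCode S⟩
  have hrat := JoinCocycle.isRationalLanguage_reducedForms_joinCocycles H hH
  exact ⟨JoinCocycle.isRationalSubset_of_reducedForms hrat, hrat,
    fun _ => JoinCocycle.reducedForms_joinCocycles H,
    fun _ => JoinCocycle.joinCocycles_of_subsingleton H⟩
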